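/- **Setting.** A *polyhedral structure* $\Pi$ on a second countable topological space $X$ is a locally finite covering of $X$ by distinct closed subsets $\sigma$ (the *polyhedra*), each with a finite dimensional real vector space $M_\sigma$ of continuous functions on $\sigma$ whose evaluation map $\phi_\sigma\colon\sigma\to N_\sigma=\operatorname{Hom}(M_\sigma,\mathbb R)$ is a homeomorphism onto a full-dimensional convex polyhedron of a hyperplane $H_\sigma\subset N_\sigma$ not passing through $0$, such that every face $\tau$ of a polyhedron $\sigma$ (the empty set included) is a polyhedron with $M_\tau=\{m|_\tau : m\in M_\sigma\}$, and any two polyhedra meet in a common face. Put $\dim\sigma=\dim M_\sigma-1$. A structure $\Pi'$ is a *subdivision* of $\Pi$, written $\Pi'\ge\Pi$, if every $\sigma'\in\Pi'$ is contained in some $\sigma\in\Pi$, the inclusion being affine; two structures are *equivalent* if they have a common subdivision. Let $X$ be a *Euclidean polyhedral space*: a second countable space with an equivalence class of polyhedral structures, a finite dimensional Euclidean vector space $N$ and a map $\iota\colon X\to N$ with image in an affine hyperplane not containing $0$, such that $\iota$ is affine and injective on each polyhedron of some structure in the class. A *polyhedral complex* on $X$ is a structure in the class on each of whose polyhedra $\iota$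 is affine and injective. Let $U\subset X$ be open, and $\Pi|_U=\{\sigma\in\Pi : \sigma\cap U\neq\emptyset\}$, with $\Pi|_U(k)$ its subset of $k$-dimensional polyhedra. A *weight* of dimension $k$ on $\Pi|_U$ is a map $c\colon\Pi|_U(k)\to\mathbb R$; it is *positive* if $c\ge 0$. It is a *Minkowski weight* if $\sum_{\sigma}c(\sigma)\,v_{\sigma\setminus\tau}=0$ for all $\tau\in\Pi|_U(k-1)$, the sum being over the $\sigma\in\Pi|_U(k)$ having $\tau$ as a face, where $v_{\sigma\setminus\tau}\in N$ is the unit vector orthogonal to the affine span of $\iota(\tau)$, parallel to that of $\iota(\sigma)$, and pointing from $\tau$ towards $\sigma$. The pullback of $c$ to a subdivision $\Pi'$ takes at $\sigma'\in\Pi'|_U(k)$ the value $c(\sigma)$ if $\sigma'\subset\sigma$ for some $\sigma\in\Pi|_U(k)$, and $0$ otherwise. The $k$-dimensional *Minkowski cycles* on $U$ are the elements of $Z_k(U)=\varinjlim_\Pi\{k\text{-dimensional Minkowski weights on }\Pi|_U\}$, the limit being over the polyhedral complexes on $X$ along these pullbacks; a cycle is *positive* if it is represented by a positive Minkowski weight.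 Let $\mathrm{PA}_\Pi(U)$ be the set of functions $f\colon U\to\mathbb R$ that on $\sigma\cap U$ are given by an element of $M_\sigma$, for every $\sigma\in\Pi|_U$ (*piecewise affine functions on $U$ defined on $\Pi$*). For such $f$ and a $k$-dimensional weight $c$ on $\Pi|_U$, the weight $f\cdot c$ of dimension $k-1$ is $$(f\cdot c)(\tau)=-\sum_{\sigma\succ\tau}c(\sigma)\,f_\sigma(v_{\sigma\setminus\tau}),$$ where $f_\sigma$ is a linear function on $N$ with $f=f_\sigma\circ\iota$ on $\sigma\cap U$. This induces products $f\cdot[c]=[f\cdot c]$ of piecewise affine functions with Minkowski cycles. A piecewise affine function $f$ on $U$ is *concave* if for every open $V\subset U$, every $k\ge 0$ and every positive Minkowski cycle $\gamma\in Z_k(V)$, the product $f|_V\cdot\gamma$ is a positive Minkowski cycle on $V$. Let $\mathrm{CPA}_\Pi(U)$ be the set of concave functions in $\mathrm{PA}_\Pi(U)$. **Theorem.** Let $X$ be a Euclidean polyhedral space, $U\subset X$ an open subset, and $\Pi$ a polyhedral complex on $X$ such that $\Pi|_U$ is finite. Then there is a polyhedral complex $\Pi'$ on $X$ that is a subdivision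 of $\Pi$ and such that for every $g\in\mathrm{PA}_{\Pi'}(U)$ there are $f_1,f_2\in\mathrm{CPA}_{\Pi'}(U)$ with $$g=f_1-f_2 .$$ -/

import Mathlib

namespace PolyhedralSpaces

open scoped InnerProductSpace

universe u v

/-! ### Convex polyhedra and their faces -/

section Convex

variable {E : Type*} [AddCommGroup E] [Module ℝ E]

/-- A convex polyhedron of a real vector space: an intersection of finitely many closed
half-spaces. The empty set and the whole space are allowed. -/
def IsPolyhedron (P : Set E) : Prop :=
  ∃ s : Finset (Module.Dual ℝ E × ℝ), P = {x | ∀ p ∈ s, p.1 x ≤ p.2}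

/-- A face of a convex set `C` in the sense of Rockafellar: a convex subset `F` of `C` such that
every segment of `C` with an interior point in `F` has both endpoints in `F`.
The empty set and `C` itself are faces of a convex set `C`. -/
def IsConvexFace (C F : Set E) : Prop :=
  Convex ℝ F ∧ IsExtreme ℝ C F

end Convex

/-! ### Polyhedral structures -/

section Charts

variable {X : Type u} [TopologicalSpace X] {s : Set X}

/-- The evaluation map `φ : s → Hom(M, ℝ)` of a vector space `M` of continuous functions on `s`. -/
def evalMap (M : Submodule ℝ C(s, ℝ)) (x : s) : Module.Dual ℝ M where
  toFun m := (m : C(s, ℝ)) x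
  map_add' _ _ := rfl
  map_smul' _ _ := rfl

/-- The finite dimensional vector space `M` of continuous functions on `s` makes `s` a polyhedron:
the evaluation map sends `s` homeomorphically onto a full-dimensional convex polyhedron of a
hyperplane `H` of `N = Hom(M, ℝ)` not passing through the origin. -/
structure IsPolyhedralChart (M : Submodule ℝ C(s, ℝ)) : Prop where
  finiteDimensional : FiniteDimensional ℝ M
  /-- The topology of the finite dimensional space `N` is that of pointwise convergence on `M`. -/
  isEmbedding : Topology.IsEmbedding (fun (x : s) (m : M) => evalMap M x m)
  isPolyhedron : IsPolyhedron (Set.range (evalMap M))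
  /-- The hyperplanes of `N` not passing through the origin are the sets `{n | n m = 1}` with
  `m ≠ 0`. If `s` is nonempty, the equality forces `m ≠ 0`. If `s` is empty then `M = 0`, and both
  sides are empty, so that the empty set is the polyhedron of dimension `-1`. -/
  fullDimensional : ∃ m : M,
    (affineSpan ℝ (Set.range (evalMap M)) : Set (Module.Dual ℝ M)) = {n | n m = 1}

/-- `t` is a face of the polyhedron `s`: its image under the evaluation map is a face
of the image of `s`. -/
def IsFaceOf (M : Submodule ℝ C(s, ℝ)) (t : Set X) : Prop :=
  t ⊆ s ∧ IsConvexFace (Set.range (evalMap M)) (evalMap M '' ((↑) ⁻¹' t))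

/-- A map from the polyhedron `s` to a vector space is affine if it is affine for the affine
structure of `s` given by its inclusion in `N = Hom(M, ℝ)`. -/
def IsAffineOn {E : Type*} [AddCommGroup E] [Module ℝ E] (M : Submodule ℝ C(s, ℝ))
    (h : s → E) : Prop :=
  ∃ L : Module.Dual ℝ M →ᵃ[ℝ] E, ∀ x : s, h x = L (evalMap M x)

end Charts

/-- A polyhedral structure on `X`. -/
structure PolyhedralStructure (X : Type u) [TopologicalSpace X] where
  /-- the polyhedra `σ` -/
  polyhedra : Set (Set X)
  /-- the space `M_σ` of functions on `σ` -/
  aff : (σ : polyhedra) → Submodule ℝ C((σ : Set X), ℝ)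
  isClosed : ∀ σ ∈ polyhedra, IsClosed σ
  cover : ⋃₀ polyhedra = Set.univ
  locallyFinite : LocallyFinite (fun σ : polyhedra => (σ : Set X))
  chart : ∀ σ : polyhedra, IsPolyhedralChart (aff σ)
  /-- Every face `τ` of a polyhedron `σ` is a polyhedron, and `M_τ` consists of the restrictions
  to `τ` of the functions in `M_σ`. -/
  face_mem : ∀ (σ : polyhedra) (τ : Set X), IsFaceOf (aff σ) τ →
    ∃ hτ : τ ∈ polyhedra, ∀ g : C(τ, ℝ), g ∈ aff ⟨τ, hτ⟩ ↔
      ∃ m ∈ aff σ, ∀ (x : X) (hxτ : x ∈ τ) (hxσ : x ∈ (σ : Set X)), g ⟨x, hxτ⟩ = m ⟨x, hxσ⟩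
  /-- Every two polyhedra intersect in a common face (possibly the empty one). -/
  inter_face : ∀ σ τ : polyhedra,
    IsFaceOf (aff σ) ((σ : Set X) ∩ τ) ∧ IsFaceOf (aff τ) ((σ : Set X) ∩ τ)

namespace PolyhedralStructure

variable {X : Type u} [TopologicalSpace X]

/-- `K'` is a subdivision of `K`: every polyhedron of `K'` is contained in a polyhedron of `K`,
the inclusion being an affine map. -/
def IsSubdivision (K' K : PolyhedralStructure X) : Prop :=
  ∀ σ' : K'.polyhedra, ∃ σ : K.polyhedra, ∃ h : (σ' : Set X) ⊆ σ,
    IsAffineOn (K'.aff σ') (fun x => evalMap (K.aff σ) (Set.inclusion h x))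

/-- Two polyhedral structures are equivalent if they admit a common subdivision. -/
def Equivalent (K₁ K₂ : PolyhedralStructure X) : Prop :=
  ∃ K : PolyhedralStructure X, K.IsSubdivision K₁ ∧ K.IsSubdivision K₂

/-- The dimension of a polyhedron; it is `-1` for the empty one. -/
noncomputable def dim (K : PolyhedralStructure X) (σ : K.polyhedra) : ℤ :=
  (Module.finrank ℝ (K.aff σ) : ℤ) - 1

/-- `τ` is a face of `σ`, for polyhedra of the same structure. -/
def Face (K : PolyhedralStructure X) (τ σ : K.polyhedra) : Prop :=
  IsFaceOf (K.aff σ) (τ : Set X)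

/-- The restriction `K|_U`: the set of polyhedra of `K` that meet `U`. -/
def restriction (K : PolyhedralStructure X) (U : TopologicalSpace.Opens X) : Set K.polyhedra :=
  {σ | ((σ : Set X) ∩ U).Nonempty}

/-- The set `K|_U(k)` of polyhedra of `K|_U` of dimension `k`. -/
def cells (K : PolyhedralStructure X) (U : TopologicalSpace.Opens X) (k : ℤ) : Set K.polyhedra :=
  {σ | σ ∈ K.restriction U ∧ K.dim σ = k}

/-- A weight on `K|_U` of dimension `k`. -/
abbrev Weight (K : PolyhedralStructure X) (U : TopologicalSpace.Opens X) (k : ℤ) : Type u :=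
  K.cells U k → ℝ

open Classical in
/-- The pullback of a weight on `K|_U` to a subdivision `K'` of `K`: its value at `σ'` is the value
of the weight at the polyhedron of `K|_U` of the same dimension that contains `σ'`, and zero if
there is none. -/
noncomputable def pullback {K : PolyhedralStructure X} {U : TopologicalSpace.Opens X} {k : ℤ}
    (c : K.Weight U k) (K' : PolyhedralStructure X) : K'.Weight U k := fun σ' =>
  if h : ∃ σ : K.cells U k, ((σ' : K'.polyhedra) : Set X) ⊆ (σ : K.polyhedra)
  then c h.choose else 0

/-- The set `PA_K(U)` of piecewise affine functions on `U` defined on `K`: on `σ ∩ U` they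
are given by an element of `M_σ`, for every `σ` in `K|_U`. -/
def PA (K : PolyhedralStructure X) (U : TopologicalSpace.Opens X) : Set (U → ℝ) :=
  {f | ∀ σ ∈ K.restriction U, ∃ m ∈ K.aff σ,
    ∀ (x : X) (hU : x ∈ U) (hσ : x ∈ (σ : Set X)), f ⟨x, hU⟩ = m ⟨x, hσ⟩}

end PolyhedralStructure

/-! ### Polyhedral spaces -/

/-- A polyhedral space: a (second countable) topological space with an equivalence class of
polyhedral structures. -/
structure PolyhedralSpace (X : Type u) [TopologicalSpace X] where
  complexes : Set (PolyhedralStructure X)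
  isClass : ∃ K₀ : PolyhedralStructure X, complexes = {K | K₀.Equivalent K}

/-- The map `ι` is affine and injective on each polyhedron of `K`. -/
def IsAdapted {X : Type u} [TopologicalSpace X] {N : Type v} [AddCommGroup N] [Module ℝ N]
    (ι : X → N) (K : PolyhedralStructure X) : Prop :=
  ∀ σ : K.polyhedra, IsAffineOn (K.aff σ) (fun x => ι x) ∧ Set.InjOn ι σ

/-- A quasi-embedded polyhedral space. It is a Euclidean polyhedral space when `N` is
a Euclidean vector space. -/
structure QuasiEmbeddedPolyhedralSpace (X : Type u) [TopologicalSpace X] (N : Type v)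
    [AddCommGroup N] [Module ℝ N] extends PolyhedralSpace X where
  /-- the quasi-embedding -/
  ι : X → N
  /-- The image of `ι` lies in an affine hyperplane not containing zero. -/
  hyperplane : ∃ ℓ : Module.Dual ℝ N, ℓ ≠ 0 ∧ ∀ x, ℓ (ι x) = 1
  exists_adapted : ∃ K ∈ complexes, IsAdapted ι K

/-- A polyhedral complex on the quasi-embedded polyhedral space `P`. -/
def QuasiEmbeddedPolyhedralSpace.IsComplex {X : Type u} [TopologicalSpace X] {N : Type v}
    [AddCommGroup N] [Module ℝ N] (P : QuasiEmbeddedPolyhedralSpace X N)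
    (K : PolyhedralStructure X) : Prop :=
  K ∈ P.complexes ∧ IsAdapted P.ι K

/-! ### Minkowski weights, Minkowski cycles and concave piecewise affine functions -/

section Euclidean

variable {X : Type u} [TopologicalSpace X] {N : Type v} [NormedAddCommGroup N]
  [InnerProductSpace ℝ N]

/-- `v` is a unit vector orthogonal to the affine span of `ι(τ)`, parallel to the affine span of
`ι(σ)`, and pointing towards `σ` from `τ`. The spans of `ι(τ)` and `ι(σ)` are `ι(H_τ)`
and `ι(H_σ)`. -/
def IsUnitNormal (ι : X → N) (τ σ : Set X) (v : N) : Prop :=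
  ‖v‖ = 1 ∧ v ∈ (vectorSpan ℝ (ι '' τ))ᗮ ∧ v ∈ vectorSpan ℝ (ι '' σ) ∧
    ∀ x ∈ τ, ∀ y ∈ σ, 0 ≤ ⟪v, ι y - ι x⟫_ℝ

/-- The unit vector normal to `τ` in the direction of `σ`, for a nonempty facet `τ` of `σ`. -/
noncomputable def unitNormal (ι : X → N) (τ σ : Set X) : N :=
  Classical.epsilon (IsUnitNormal ι τ σ)

/-- A linear function `f_σ` on `N` such that `f = f_σ ∘ ι` on `σ ∩ U`. -/
noncomputable def linearPart (ι : X → N) {U : TopologicalSpace.Opens X} (f : U → ℝ) (σ : Set X) :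
    Module.Dual ℝ N :=
  Classical.epsilon fun ℓ => ∀ (x : X) (hU : x ∈ U), x ∈ σ → f ⟨x, hU⟩ = ℓ (ι x)

namespace PolyhedralStructure

variable {K : PolyhedralStructure X} {U : TopologicalSpace.Opens X} {k : ℤ}

/-- The weight `c` of dimension `k` on `K|_U` is a Minkowski weight: it is balanced at
every `τ` in `K|_U(k-1)`. The sum, over the `σ` in `K|_U(k)` having `τ` as a facet, is finite. -/
def IsMinkowski (ι : X → N) (c : K.Weight U k) : Prop :=
  ∀ τ : K.cells U (k - 1),
    ∑ᶠ (σ : K.cells U k) (_ : K.Face τ σ),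
      c σ • unitNormal ι (τ : K.polyhedra) (σ : K.polyhedra) = 0

/-- The product of a piecewise affine function on `U` defined on `K` with a weight on `K|_U`. -/
noncomputable def prod (ι : X → N) (f : U → ℝ) (c : K.Weight U k) : K.Weight U (k - 1) := fun τ =>
  -∑ᶠ (σ : K.cells U k) (_ : K.Face τ σ),
    c σ * linearPart ι f (σ : K.polyhedra) (unitNormal ι (τ : K.polyhedra) (σ : K.polyhedra))

end PolyhedralStructure

namespace QuasiEmbeddedPolyhedralSpace

variable (P : QuasiEmbeddedPolyhedralSpace X N)

/-- A Minkowski weight of dimension `k` over `U`, on some polyhedral complex on `P`. -/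
structure MinkowskiWeight (U : TopologicalSpace.Opens X) (k : ℤ) where
  K : PolyhedralStructure X
  isComplex : P.IsComplex K
  c : K.Weight U k
  isMinkowski : PolyhedralStructure.IsMinkowski P.ι c

/-- `b` is the pullback of `a` to a subdivision. -/
def IsPullback {U : TopologicalSpace.Opens X} {k : ℤ} (a b : P.MinkowskiWeight U k) : Prop :=
  b.K.IsSubdivision a.K ∧ b.c = PolyhedralStructure.pullback a.c b.K

/-- The set `Z_k(U)` of Minkowski cycles: the direct limit, over the polyhedral complexes `K` on
the space, of the sets of Minkowski weights on `K|_U` along the pullback maps. -/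
def Cycle (U : TopologicalSpace.Opens X) (k : ℤ) : Type u :=
  Quot (P.IsPullback (U := U) (k := k))

variable {P}

/-- The Minkowski cycle represented by a Minkowski weight. -/
def MinkowskiWeight.cycle {U : TopologicalSpace.Opens X} {k : ℤ} (a : P.MinkowskiWeight U k) :
    P.Cycle U k :=
  Quot.mk _ a

/-- A Minkowski cycle is positive if it is represented by a positive Minkowski weight. -/
def Cycle.IsPositive {U : TopologicalSpace.Opens X} {k : ℤ} (γ : P.Cycle U k) : Prop :=
  ∃ a : P.MinkowskiWeight U k, a.cycle = γ ∧ ∀ σ, 0 ≤ a.c σ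

variable (P)

/-- The piecewise affine function `f` on `U` is concave: for every positive Minkowski cycle `γ` on
an open subset `V` of `U`, the product `f · γ` is a positive Minkowski cycle on `V`. Here
`f · γ = [f · c]` for any Minkowski weight `c` representing `γ` on a polyhedral complex on which
the restriction of `f` to `V` is defined. -/
def IsConcave {U : TopologicalSpace.Opens X} (f : U → ℝ) : Prop :=
  ∀ (V : TopologicalSpace.Opens X) (hVU : V ≤ U) (k : ℕ) (γ : P.Cycle V k), γ.IsPositive →
    ∀ a : P.MinkowskiWeight V k, a.cycle = γ →
      (fun x : V => f ⟨x, hVU x.2⟩) ∈ a.K.PA V →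
        ∃ h : PolyhedralStructure.IsMinkowski P.ι
            (PolyhedralStructure.prod P.ι (fun x : V => f ⟨x, hVU x.2⟩) a.c),
          (MinkowskiWeight.cycle (P := P) ⟨a.K, a.isComplex, _, h⟩).IsPositive

/-- The set `CPA_K(U)` of concave piecewise affine functions on `U` defined on `K`. -/
def CPA (K : PolyhedralStructure X) (U : TopologicalSpace.Opens X) : Set (U → ℝ) :=
  {f | f ∈ K.PA U ∧ P.IsConcave f}

end QuasiEmbeddedPolyhedralSpace

end Euclidean

end PolyhedralSpaces

namespace PolyhedralSpaces

open scoped InnerProductSpace Topology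

section Relint

variable {E : Type*} [AddCommGroup E] [Module ℝ E]

/-- The algebraic relative interior: the points of `C` through which every segment of `C` ending
there can be prolonged inside `C`. -/
def relint (C : Set E) : Set E :=
  {x | x ∈ C ∧ ∀ y ∈ C, ∃ ε : ℝ, 0 < ε ∧ x + ε • (x - y) ∈ C}

theorem mem_openSegment_prolong (x y : E) {ε : ℝ} (hε : 0 < ε) :
    x ∈ openSegment ℝ y (x + ε • (x - y)) := by
  have h1 : (1 + ε) ≠ 0 := by positivity
  refine ⟨ε / (1 + ε), 1 / (1 + ε), by positivity, by positivity,
    by rw [← add_div, add_comm ε, div_self h1], ?_⟩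
  have : (1 / (1 + ε)) * (1 + ε) = 1 := by field_simp
  calc (ε / (1 + ε)) • y + (1 / (1 + ε)) • (x + ε • (x - y))
      = ((1 / (1 + ε)) * (1 + ε)) • x := by module
    _ = x := by rw [this, one_smul]

theorem subset_of_mem_relint {C F G : Set E} (hF : IsExtreme ℝ C F) (hG : G ⊆ C) {x : E}
    (hx : x ∈ relint G) (hxF : x ∈ F) : G ⊆ F := by
  intro y hy
  obtain ⟨ε, hε, h⟩ := hx.2 y hy
  exact hF.2 (hG hy) (hG h) hxF (mem_openSegment_prolong x y hε)

theorem add_smul_mem_of_le {C : Set E} (hC : Convex ℝ C) {x v : E} {ε δ : ℝ} (hx : x ∈ C)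
    (h : x + ε • v ∈ C) (hδ : 0 ≤ δ) (hle : δ ≤ ε) : x + δ • v ∈ C := by
  rcases hδ.eq_or_lt with rfl | hδ
  · simpa using hx
  have hε : 0 < ε := hδ.trans_le hle
  have := hC hx h (a := 1 - δ / ε) (b := δ / ε) (by rw [sub_nonneg, div_le_one hε]; exact hle)
    (by positivity) (by ring)
  convert this using 1
  have h2 : δ / ε * ε = δ := by field_simp
  calc x + δ • v = x + (δ / ε * ε) • v := by rw [h2]
    _ = _ := by module

theorem lineMap_mem_relint {C : Set E} (hC : Convex ℝ C) {x y : E} (hx : x ∈ relint C)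
    (hy : y ∈ C) {t : ℝ} (ht : 0 < t) (ht1 : t ≤ 1) : y + t • (x - y) ∈ relint C := by
  have hz : y + t • (x - y) ∈ C := by
    have := hC hy hx.1 (a := 1 - t) (b := t) (by linarith) ht.le (by ring)
    convert this using 1; module
  refine ⟨hz, fun w hw => ?_⟩
  obtain ⟨ε, hε, h⟩ := hx.2 w hw
  -- `z + δ (z - w) = (1 - s) y + s (x + ε (x - w))` with `s ε = δ`, `s (1 + ε) = t (1 + δ)`
  have hpos : 0 < 1 + ε - t * ε := by nlinarith
  have hs1 : t / (1 + ε - t * ε) ≤ 1 := by rw [div_le_one hpos]; nlinarith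
  set s := t / (1 + ε - t * ε) with hs
  have hs0 : 0 < s := by positivity
  have key : s * (1 + ε - t * ε) = t := by rw [hs]; field_simp
  refine ⟨s * ε, by positivity, ?_⟩
  have := hC hy h (a := 1 - s) (b := s) (by linarith) hs0.le (by ring)
  convert this using 1
  have e1 : s * (1 + ε) = t * (1 + s * ε) := by linear_combination key
  have e2 : (1 - s) = (1 - t) * (1 + s * ε) := by linear_combination -key
  calc y + t • (x - y) + (s * ε) • (y + t • (x - y) - w)
      = ((1 - t) * (1 + s * ε)) • y + (t * (1 + s * ε)) • x - (s * ε) • w := by module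
    _ = (1 - s) • y + (s * (1 + ε)) • x - (s * ε) • w := by rw [e2, e1]
    _ = _ := by module

theorem exists_smul_sub_of_mem_span {C : Set E} (hC : Convex ℝ C) (hne : C.Nonempty) {n : E}
    (hn : n ∈ Submodule.span ℝ C) :
    ∃ t s : ℝ, 0 ≤ t ∧ 0 ≤ s ∧ ∃ a ∈ C, ∃ b ∈ C, n = t • a - s • b := by
  have comb : ∀ t s : ℝ, 0 ≤ t → 0 ≤ s → ∀ a ∈ C, ∀ b ∈ C, ∃ c ∈ C,
      t • a + s • b = (t + s) • c := by
    intro t s ht hs a ha b hb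
    rcases (add_nonneg ht hs).eq_or_lt with h | h
    · refine ⟨a, ha, ?_⟩
      have h1 : t = 0 := by linarith
      have h2 : s = 0 := by linarith
      simp [h1, h2]
    · refine ⟨(t / (t + s)) • a + (s / (t + s)) • b,
        hC ha hb (by positivity) (by positivity) (by field_simp), ?_⟩
      rw [smul_add, smul_smul, smul_smul, mul_div_cancel₀ _ h.ne', mul_div_cancel₀ _ h.ne']
  obtain ⟨x₀, hx₀⟩ := hne
  induction hn using Submodule.span_induction with
  | mem x hx => exact ⟨1, 0, zero_le_one, le_rfl, x, hx, x, hx, by simp⟩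
  | zero => exact ⟨0, 0, le_rfl, le_rfl, x₀, hx₀, x₀, hx₀, by simp⟩
  | add x y _ _ hx hy =>
    obtain ⟨t, s, ht, hs, a, ha, b, hb, rfl⟩ := hx
    obtain ⟨t', s', ht', hs', a', ha', b', hb', rfl⟩ := hy
    obtain ⟨c, hc, h1⟩ := comb t t' ht ht' a ha a' ha'
    obtain ⟨d, hd, h2⟩ := comb s s' hs hs' b hb b' hb'
    exact ⟨t + t', s + s', by positivity, by positivity, c, hc, d, hd, by
      rw [← h1, ← h2]; abel⟩
  | smul r x _ hx =>
    obtain ⟨t, s, ht, hs, a, ha, b, hb, rfl⟩ := hx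
    rcases le_total 0 r with hr | hr
    · exact ⟨r * t, r * s, by positivity, by positivity, a, ha, b, hb, by module⟩
    · exact ⟨-r * s, -r * t, mul_nonneg (by linarith) hs, mul_nonneg (by linarith) ht, b, hb, a, ha,
        by module⟩

/-- In a convex set of the hyperplane `ℓ = 1`, the elements of the linear span on which `ℓ`
vanishes are multiples of differences of points. -/
theorem exists_smul_sub_of_mem_span_of_eq_zero {C : Set E} (hC : Convex ℝ C) (hne : C.Nonempty)
    {ℓ : Module.Dual ℝ E} (hℓ : ∀ x ∈ C, ℓ x = 1) {v : E} (hv : v ∈ Submodule.span ℝ C)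
    (h0 : ℓ v = 0) : ∃ t : ℝ, 0 ≤ t ∧ ∃ a ∈ C, ∃ b ∈ C, v = t • (a - b) := by
  obtain ⟨t, s, ht, -, a, ha, b, hb, rfl⟩ := exists_smul_sub_of_mem_span hC hne hv
  have : t = s := by simpa [hℓ a ha, hℓ b hb, sub_eq_zero] using h0
  subst this
  exact ⟨t, ht, a, ha, b, hb, by module⟩

theorem exists_add_smul_mem_of_mem_relint {C : Set E} (hC : Convex ℝ C)
    {ℓ : Module.Dual ℝ E} (hℓ : ∀ x ∈ C, ℓ x = 1) {x v : E} (hx : x ∈ relint C)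
    (hv : v ∈ Submodule.span ℝ C) (h0 : ℓ v = 0) : ∃ ε : ℝ, 0 < ε ∧ x + ε • v ∈ C := by
  obtain ⟨t, ht, a, ha, b, hb, rfl⟩ := exists_smul_sub_of_mem_span_of_eq_zero hC ⟨x, hx.1⟩ hℓ hv h0
  obtain ⟨ε, hε, h⟩ := hx.2 b hb
  set δ := min ε 1 with hδ
  have hδ0 : 0 < δ := lt_min hε one_pos
  have h1 : x + δ • (x - b) ∈ C := add_smul_mem_of_le hC hx.1 h hδ0.le (min_le_left _ _)
  have h2 : x + δ • (a - x) ∈ C :=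
    add_smul_mem_of_le hC hx.1 (ε := 1) (by simpa using ha) hδ0.le (min_le_right _ _)
  have h3 : x + (δ / 2) • (a - b) ∈ C := by
    have := hC h1 h2 (a := 1 / 2) (b := 1 / 2) (by norm_num) (by norm_num) (by norm_num)
    convert this using 1; module
  refine ⟨δ / 2 / (t + 1), by positivity, ?_⟩
  rw [smul_smul]
  refine add_smul_mem_of_le hC hx.1 h3 (by positivity) ?_
  rw [div_mul_eq_mul_div, div_le_iff₀ (by positivity)]
  nlinarith

/-- A nonempty face of a convex set is the intersection with its linear span. -/
theorem mem_of_mem_span_of_isExtreme {C F : Set E} (hF : IsExtreme ℝ C F) (hFc : Convex ℝ F)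
    (hrel : (relint F).Nonempty) {ℓ : Module.Dual ℝ E} (hℓ : ∀ x ∈ C, ℓ x = 1) {y : E}
    (hy : y ∈ C) (hyF : y ∈ Submodule.span ℝ F) : y ∈ F := by
  obtain ⟨x, hx⟩ := hrel
  have hℓF : ∀ x ∈ F, ℓ x = 1 := fun x hx => hℓ x (hF.1 hx)
  obtain ⟨ε, hε, h⟩ := exists_add_smul_mem_of_mem_relint hFc hℓF hx
    (v := x - y) (sub_mem (Submodule.subset_span hx.1) hyF) (by simp [hℓF x hx.1, hℓ y hy])
  exact hF.2 hy (hF.1 h) hx.1 (mem_openSegment_prolong x y hε)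

theorem mem_vectorSpan_iff_mem_span {C : Set E} {ℓ : Module.Dual ℝ E} (hℓ : ∀ x ∈ C, ℓ x = 1) {v : E}
    (hne : C.Nonempty) : v ∈ vectorSpan ℝ C ↔ v ∈ Submodule.span ℝ C ∧ ℓ v = 0 := by
  obtain ⟨p, hp⟩ := hne
  constructor
  · intro hv
    rw [vectorSpan_def] at hv
    induction hv using Submodule.span_induction with
    | mem x hx =>
      obtain ⟨a, ha, b, hb, rfl⟩ := hx
      exact ⟨sub_mem (Submodule.subset_span ha) (Submodule.subset_span hb), by
        simp [hℓ a ha, hℓ b hb]⟩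
    | zero => exact ⟨zero_mem _, map_zero _⟩
    | add x y _ _ hx hy => exact ⟨add_mem hx.1 hy.1, by rw [map_add, hx.2, hy.2, add_zero]⟩
    | smul a x _ hx => exact ⟨Submodule.smul_mem _ _ hx.1, by rw [map_smul, hx.2, smul_zero]⟩
  · rintro ⟨hv, h0⟩
    have : ∀ v ∈ Submodule.span ℝ C, v - ℓ v • p ∈ vectorSpan ℝ C := by
      intro v hv
      induction hv using Submodule.span_induction with
      | mem x hx => rw [hℓ x hx, one_smul]; exact vsub_mem_vectorSpan ℝ hx hp
      | zero => simp
      | add x y _ _ hx hy =>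
        convert add_mem hx hy using 1; rw [map_add]; module
      | smul a x _ hx =>
        convert Submodule.smul_mem _ a hx using 1; rw [map_smul, smul_eq_mul]; module
    simpa [h0] using this v hv

end Relint

section Polyhedra

variable {E F : Type*} [AddCommGroup E] [Module ℝ E] [AddCommGroup F] [Module ℝ F]

theorem IsPolyhedron.convex {P : Set E} (h : IsPolyhedron P) : Convex ℝ P := by
  obtain ⟨s, rfl⟩ := h
  intro x hx y hy a b ha hb hab p hp
  have h1 := mul_le_mul_of_nonneg_left (hx p hp) ha
  have h2 := mul_le_mul_of_nonneg_left (hy p hp) hb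
  rw [map_add, map_smul, map_smul, smul_eq_mul, smul_eq_mul]
  calc _ ≤ a * p.2 + b * p.2 := add_le_add h1 h2
    _ = p.2 := by rw [← add_mul, hab, one_mul]

theorem IsPolyhedron.inter {P Q : Set E} (hP : IsPolyhedron P) (hQ : IsPolyhedron Q) :
    IsPolyhedron (P ∩ Q) := by
  classical
  obtain ⟨s, rfl⟩ := hP
  obtain ⟨t, rfl⟩ := hQ
  refine ⟨s ∪ t, ?_⟩
  ext x
  simp only [Set.mem_inter_iff, Set.mem_ofPred_eq, Finset.mem_union]
  exact ⟨fun h p hp => hp.elim (h.1 p) (h.2 p), fun h => ⟨fun p hp => h p (.inl hp),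
    fun p hp => h p (.inr hp)⟩⟩

theorem isPolyhedron_univ : IsPolyhedron (Set.univ : Set E) := ⟨∅, by simp⟩

theorem isPolyhedron_halfspace (p : Module.Dual ℝ E) (b : ℝ) : IsPolyhedron {x | p x ≤ b} :=
  ⟨{(p, b)}, by simp⟩

theorem isPolyhedron_halfspace_ge (p : Module.Dual ℝ E) (b : ℝ) : IsPolyhedron {x | b ≤ p x} := by
  convert isPolyhedron_halfspace (-p) (-b) using 3
  simp

theorem isPolyhedron_hyperplane (p : Module.Dual ℝ E) (b : ℝ) : IsPolyhedron {x | p x = b} := by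
  convert (isPolyhedron_halfspace p b).inter (isPolyhedron_halfspace_ge p b) using 1
  ext x; exact le_antisymm_iff

theorem isPolyhedron_iInter {J : Type*} [Finite J] {P : J → Set E} (h : ∀ j, IsPolyhedron (P j)) :
    IsPolyhedron (⋂ j, P j) := by
  classical
  cases nonempty_fintype J
  have : ∀ t : Finset J, IsPolyhedron (⋂ j ∈ t, P j) := by
    intro t
    induction t using Finset.induction_on with
    | empty => simpa using isPolyhedron_univ
    | insert a t _ ih => rw [Finset.set_biInter_insert]; exact (h a).inter ih
  simpa using this Finset.univ

theorem IsPolyhedron.preimage {P : Set F} (h : IsPolyhedron P) (f : E →ₗ[ℝ] F) :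
    IsPolyhedron (f ⁻¹' P) := by
  classical
  obtain ⟨s, rfl⟩ := h
  refine ⟨s.image fun p => (p.1.comp f, p.2), ?_⟩
  ext x
  refine ⟨fun h p hp => ?_, fun h p hp => h (p.1.comp f, p.2) (Finset.mem_image_of_mem _ hp)⟩
  obtain ⟨q, hq, rfl⟩ := Finset.mem_image.1 hp
  exact h q hq

theorem isPolyhedron_submodule [FiniteDimensional ℝ E] (W : Submodule ℝ E) :
    IsPolyhedron (W : Set E) := by
  let b := Module.finBasis ℝ (E ⧸ W)
  convert isPolyhedron_iInter fun j =>
    isPolyhedron_hyperplane ((b.coord j).comp W.mkQ) 0 using 1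
  ext x
  simp only [SetLike.mem_coe, Set.mem_iInter, Set.mem_ofPred_eq, LinearMap.comp_apply,
    b.forall_coord_eq_zero_iff, Submodule.mkQ_apply, Submodule.Quotient.mk_eq_zero]

theorem IsPolyhedron.image [FiniteDimensional ℝ F] {P : Set E} (h : IsPolyhedron P)
    (f : E →ₗ[ℝ] F) (hf : Function.Injective f) : IsPolyhedron (f '' P) := by
  obtain ⟨g, hg⟩ := f.exists_leftInverse_of_injective (LinearMap.ker_eq_bot.mpr hf)
  have hg' : ∀ x, g (f x) = x := fun x => LinearMap.congr_fun hg x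
  convert (h.preimage g).inter (isPolyhedron_submodule (LinearMap.range f)) using 1
  ext y
  constructor
  · rintro ⟨x, hx, rfl⟩
    exact ⟨by simpa [hg'] using hx, x, rfl⟩
  · rintro ⟨h1, x, rfl⟩
    exact ⟨x, by simpa [hg'] using h1, rfl⟩

/-- Every point of a polyhedron lies in the relative interior of a face. -/
theorem IsPolyhedron.exists_face {P : Set E} (h : IsPolyhedron P) {x : E} (hx : x ∈ P) :
    ∃ F, IsConvexFace P F ∧ x ∈ relint F := by
  obtain ⟨s, rfl⟩ := h
  refine ⟨{y | (∀ p ∈ s, p.1 y ≤ p.2) ∧ ∀ p ∈ s, p.1 x = p.2 → p.1 y = p.2}, ⟨?_, ?_, ?_⟩,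
    ⟨hx, fun _ _ h => h⟩, ?_⟩
  · intro y hy z hz a b ha hb hab
    refine ⟨IsPolyhedron.convex ⟨s, rfl⟩ hy.1 hz.1 ha hb hab, fun p hp hpx => ?_⟩
    rw [map_add, map_smul, map_smul, hy.2 p hp hpx, hz.2 p hp hpx, ← add_smul, hab, one_smul]
  · exact fun y hy => hy.1
  · rintro y hy z hz w hw ⟨a, b, ha, hb, hab, rfl⟩
    refine ⟨hy, fun p hp hpx => ?_⟩
    have h1 := hw.2 p hp hpx
    rw [map_add, map_smul, map_smul, smul_eq_mul, smul_eq_mul] at h1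
    have h2 := hy p hp
    have h3 := hz p hp
    refine le_antisymm h2 ?_
    by_contra! hlt
    have h4 := mul_lt_mul_of_pos_left hlt ha
    have h5 := mul_le_mul_of_nonneg_left h3 hb.le
    have h6 : a * p.2 + b * p.2 = p.2 := by rw [← add_mul, hab, one_mul]
    linarith
  · rintro y ⟨hy, hy'⟩
    have key : ∀ p ∈ s, ∀ᶠ ε in 𝓝[>] (0 : ℝ), p.1 (x + ε • (x - y)) ≤ p.2 := by
      intro p hp
      rcases (hx p hp).eq_or_lt with h | h
      · refine Filter.Eventually.of_forall fun ε => ?_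
        simp [h, hy' p hp h]
      · have : Filter.Tendsto (fun ε : ℝ => p.1 x + ε * (p.1 x - p.1 y)) (𝓝[>] 0)
            (𝓝 (p.1 x + 0 * (p.1 x - p.1 y))) := by
          refine Filter.Tendsto.mono_left ?_ nhdsWithin_le_nhds
          exact Continuous.tendsto (by fun_prop) 0
        rw [zero_mul, add_zero] at this
        filter_upwards [this.eventually_lt_const h] with ε hε
        simpa using hε.le
    have := (Filter.eventually_all_finset s).2 key
    obtain ⟨ε, h1, h2⟩ := (this.and self_mem_nhdsWithin).exists
    refine ⟨ε, h2, h1, fun p hp hpx => ?_⟩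
    simp [hpx, hy' p hp hpx]

end Polyhedra

section Normed

variable {N : Type*} [NormedAddCommGroup N] [NormedSpace ℝ N] [FiniteDimensional ℝ N]

theorem relint_nonempty {C : Set N} (hC : Convex ℝ C) (hne : C.Nonempty) : (relint C).Nonempty := by
  obtain ⟨x, hx⟩ := hne.intrinsicInterior hC
  obtain ⟨z, hz, rfl⟩ := mem_intrinsicInterior.1 hx
  have hzC : z ∈ ((↑) ⁻¹' C : Set (affineSpan ℝ C)) := interior_subset hz
  refine ⟨z, hzC, fun y hy => ?_⟩
  have hyS : y ∈ affineSpan ℝ C := subset_affineSpan ℝ C hy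
  have hmem : ∀ ε : ℝ, (z : N) + ε • ((z : N) - y) ∈ affineSpan ℝ C := by
    intro ε
    have := AffineMap.lineMap_mem (1 + ε) hyS z.2
    convert this using 1
    rw [AffineMap.lineMap_apply_module]; module
  let g : ℝ → affineSpan ℝ C := fun ε => ⟨(z : N) + ε • ((z : N) - y), hmem ε⟩
  have hg : Continuous g := by
    refine Continuous.subtype_mk ?_ _
    fun_prop
  have h0 : g 0 = z := by ext; simp [g]
  have : ∀ᶠ ε in 𝓝 (0 : ℝ), g ε ∈ interior ((↑) ⁻¹' C : Set (affineSpan ℝ C)) :=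
    hg.continuousAt.eventually_mem (by rw [h0]; exact isOpen_interior.mem_nhds hz)
  have h2 : ∀ᶠ ε in 𝓝[>] (0 : ℝ), g ε ∈ interior ((↑) ⁻¹' C : Set (affineSpan ℝ C)) :=
    this.filter_mono nhdsWithin_le_nhds
  obtain ⟨ε, h1, h2⟩ := (h2.and self_mem_nhdsWithin).exists
  have hmemC : g ε ∈ ((↑) ⁻¹' C : Set (affineSpan ℝ C)) := interior_subset h1
  exact ⟨ε, h2, hmemC⟩

end Normed

section LinearFunctions

set_option linter.unusedSectionVars false

variable {X N : Type*} [TopologicalSpace X] [NormedAddCommGroup N] [InnerProductSpace ℝ N]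

/-- The functions on `s` that are pulled back from linear functions on `N`. -/
def linFun (ι : X → N) (s : Set X) : Submodule ℝ C(s, ℝ) where
  carrier := {m | ∃ ℓ : Module.Dual ℝ N, ∀ x : s, m x = ℓ (ι x)}
  zero_mem' := ⟨0, by simp⟩
  add_mem' := by
    rintro a b ⟨ℓ, h⟩ ⟨ℓ', h'⟩
    exact ⟨ℓ + ℓ', fun x => by simp [h, h']⟩
  smul_mem' := by
    rintro c a ⟨ℓ, h⟩
    exact ⟨c • ℓ, fun x => by simp [h]⟩

variable [FiniteDimensional ℝ N] {ι : X → N} {s : Set X}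

/-- The pullback of linear functions on `N` to `s`. -/
noncomputable def linPullback (hc : Continuous fun x : s => ι x) :
    Module.Dual ℝ N →ₗ[ℝ] linFun ι s where
  toFun ℓ := ⟨⟨fun x => ℓ (ι x), ℓ.continuous_of_finiteDimensional.comp hc⟩, ℓ, fun _ => rfl⟩
  map_add' _ _ := rfl
  map_smul' _ _ := rfl

@[simp] theorem linPullback_apply (hc : Continuous fun x : s => ι x) (ℓ : Module.Dual ℝ N) (x : s) :
    (linPullback hc ℓ : C(s, ℝ)) x = ℓ (ι x) := rfl

theorem linPullback_surjective (hc : Continuous fun x : s => ι x) :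
    Function.Surjective (linPullback hc) := by
  rintro ⟨m, ℓ, h⟩
  exact ⟨ℓ, Subtype.ext (ContinuousMap.ext fun x => (h x).symm)⟩

theorem finiteDimensional_linFun (hc : Continuous fun x : s => ι x) :
    FiniteDimensional ℝ (linFun ι s) :=
  Module.Finite.of_surjective _ (linPullback_surjective hc)

/-- The map from the space of the evaluation map to `N`. -/
noncomputable def dualToSpace (hc : Continuous fun x : s => ι x) :
    Module.Dual ℝ (linFun ι s) →ₗ[ℝ] N :=
  (Module.evalEquiv ℝ N).symm.toLinearMap ∘ₗ (linPullback hc).dualMap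

theorem dualToSpace_injective (hc : Continuous fun x : s => ι x) :
    Function.Injective (dualToSpace hc) :=
  (Module.evalEquiv ℝ N).symm.injective.comp
    (LinearMap.dualMap_injective_of_surjective (linPullback_surjective hc))

theorem dualToSpace_evalMap (hc : Continuous fun x : s => ι x) (x : s) :
    dualToSpace hc (evalMap (linFun ι s) x) = ι x := by
  simp only [dualToSpace, LinearMap.comp_apply, LinearEquiv.coe_coe]
  rw [LinearEquiv.symm_apply_eq]
  ext ℓ
  rfl

theorem image_dualToSpace (hc : Continuous fun x : s => ι x) (t : Set X) :
    dualToSpace hc '' (evalMap (linFun ι s) '' ((↑) ⁻¹' t)) = ι '' (s ∩ t) := by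
  ext y
  constructor
  · rintro ⟨_, ⟨x, hx, rfl⟩, rfl⟩
    exact ⟨x, ⟨x.2, hx⟩, (dualToSpace_evalMap hc x).symm⟩
  · rintro ⟨x, ⟨hx, hxt⟩, rfl⟩
    exact ⟨_, ⟨⟨x, hx⟩, hxt, rfl⟩, dualToSpace_evalMap hc ⟨x, hx⟩⟩

theorem image_range_evalMap (hc : Continuous fun x : s => ι x) :
    dualToSpace hc '' Set.range (evalMap (linFun ι s)) = ι '' s := by
  have := image_dualToSpace hc Set.univ
  rwa [Set.preimage_univ, Set.image_univ, Set.inter_univ] at this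

theorem isConvexFace_image_iff {E F : Type*} [AddCommGroup E] [Module ℝ E] [AddCommGroup F]
    [Module ℝ F] (f : E →ₗ[ℝ] F) (hf : Function.Injective f) {C G : Set E} :
    IsConvexFace (f '' C) (f '' G) ↔ IsConvexFace C G := by
  have key : ∀ x y z, f z ∈ openSegment ℝ (f x) (f y) ↔ z ∈ openSegment ℝ x y := by
    intro x y z
    constructor
    · rintro ⟨a, b, ha, hb, hab, h⟩
      exact ⟨a, b, ha, hb, hab, hf (by simpa using h)⟩
    · rintro ⟨a, b, ha, hb, hab, rfl⟩
      exact ⟨a, b, ha, hb, hab, by simp⟩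
  constructor
  · rintro ⟨h1, h2, h3⟩
    refine ⟨?_, (Set.image_subset_image_iff hf).1 h2, fun x hx y hy z hz h => ?_⟩
    · have := h1.linear_preimage f
      rwa [Set.preimage_image_eq _ hf] at this
    · exact (hf.mem_set_image).1 (h3 (Set.mem_image_of_mem f hx) (Set.mem_image_of_mem f hy)
        (Set.mem_image_of_mem f hz) ((key x y z).2 h))
  · rintro ⟨h1, h2, h3⟩
    refine ⟨h1.linear_image f, Set.image_mono h2, ?_⟩
    rintro _ ⟨x, hx, rfl⟩ _ ⟨y, hy, rfl⟩ _ ⟨z, hz, rfl⟩ h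
    exact Set.mem_image_of_mem f (h3 hx hy hz ((key x y z).1 h))

theorem isFaceOf_linFun_iff (hc : Continuous fun x : s => ι x) {t : Set X} :
    IsFaceOf (linFun ι s) t ↔ t ⊆ s ∧ IsConvexFace (ι '' s) (ι '' t) := by
  refine and_congr_right fun hts => ?_
  rw [← isConvexFace_image_iff _ (dualToSpace_injective hc), image_range_evalMap,
    image_dualToSpace, Set.inter_eq_self_of_subset_right hts]

theorem span_range_evalMap {M : Submodule ℝ C(s, ℝ)} (hM : FiniteDimensional ℝ M) :
    Submodule.span ℝ (Set.range (evalMap M)) = ⊤ := by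
  rw [← Subspace.dualCoannihilator_dualAnnihilator_eq
    (W := Submodule.span ℝ (Set.range (evalMap M)))]
  rw [Submodule.dualAnnihilator_eq_top_iff, Submodule.eq_bot_iff]
  intro m hm
  rw [Submodule.mem_dualCoannihilator] at hm
  refine Subtype.ext (ContinuousMap.ext fun x => ?_)
  exact hm _ (Submodule.subset_span ⟨x, rfl⟩)

theorem range_dualToSpace (hc : Continuous fun x : s => ι x) :
    LinearMap.range (dualToSpace hc) = Submodule.span ℝ (ι '' s) := by
  rw [← image_range_evalMap hc, ← Submodule.map_span,
    span_range_evalMap (finiteDimensional_linFun hc), Submodule.map_top]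

theorem finrank_linFun (hc : Continuous fun x : s => ι x) :
    Module.finrank ℝ (linFun ι s) = Module.finrank ℝ (Submodule.span ℝ (ι '' s)) := by
  have := finiteDimensional_linFun hc
  rw [← range_dualToSpace hc, LinearMap.finrank_range_of_inj (dualToSpace_injective hc),
    Subspace.dual_finrank_eq]

theorem affineSpan_eq_of_span_eq_top {E : Type*} [AddCommGroup E] [Module ℝ E] {S : Set E}
    {ℓ : Module.Dual ℝ E} (hℓ : ∀ x ∈ S, ℓ x = 1) (hS : Submodule.span ℝ S = ⊤) :
    (affineSpan ℝ S : Set E) = {n | ℓ n = 1} := by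
  apply Set.Subset.antisymm
  · intro x hx
    refine affineSpan_induction (p := fun x => ℓ x = 1) hx hℓ ?_
    intro c u v w hu hv hw
    simp [hu, hv, hw]
  · intro n hn
    have hn1 : ℓ n = 1 := hn
    rcases S.eq_empty_or_nonempty with rfl | ⟨p, hp⟩
    · have : n ∈ Submodule.span ℝ (∅ : Set E) := hS ▸ Submodule.mem_top
      rw [Submodule.span_empty, Submodule.mem_bot] at this
      simp [this] at hn1
    · have h : n - p ∈ vectorSpan ℝ S :=
        (mem_vectorSpan_iff_mem_span hℓ ⟨p, hp⟩).2 ⟨hS ▸ Submodule.mem_top, by simp [hn1, hℓ p hp]⟩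
      have := vadd_mem_affineSpan_of_mem_affineSpan_of_mem_vectorSpan
        (subset_affineSpan ℝ S hp) h
      simpa using this

theorem isPolyhedralChart_linFun {ℓ : Module.Dual ℝ N} (hℓ : ∀ x ∈ s, ℓ (ι x) = 1)
    (he : Topology.IsEmbedding fun x : s => ι x) (hP : IsPolyhedron (ι '' s)) :
    IsPolyhedralChart (linFun ι s) := by
  have hc := he.continuous
  have hfd := finiteDimensional_linFun hc
  refine ⟨hfd, ?_, ?_, linPullback hc ℓ, ?_⟩
  · let b := Module.finBasis ℝ N
    let G : (linFun ι s → ℝ) → N := fun u => ∑ i, u (linPullback hc (b.coord i)) • b i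
    have hG : Continuous G := by
      refine continuous_finsetSum _ fun i _ => ?_
      exact (continuous_apply _).smul continuous_const
    refine Topology.IsEmbedding.of_comp ?_ hG ?_
    · exact continuous_pi fun m => (m : C(s, ℝ)).continuous
    · convert he using 1
      ext1 x
      exact b.sum_repr (ι x)
  · convert hP.preimage (dualToSpace hc) using 1
    rw [← image_range_evalMap hc, Set.preimage_image_eq _ (dualToSpace_injective hc)]
  · exact affineSpan_eq_of_span_eq_top (ℓ := Module.evalEquiv ℝ _ (linPullback hc ℓ))
      (by rintro _ ⟨x, rfl⟩; exact hℓ x x.2) (span_range_evalMap hfd)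

theorem continuous_of_forall_dual {Y : Type*} [TopologicalSpace Y] {f : Y → N}
    (h : ∀ ℓ : Module.Dual ℝ N, Continuous fun y => ℓ (f y)) : Continuous f := by
  let b := Module.finBasis ℝ N
  have : f = fun y => ∑ i, b.coord i (f y) • b i := by
    ext1 y; exact (b.sum_repr (f y)).symm
  rw [this]
  exact continuous_finsetSum _ fun i _ => (h _).smul continuous_const

theorem IsPolyhedralChart.eq_linFun {M : Submodule ℝ C(s, ℝ)} (hM : IsPolyhedralChart M)
    {ℓ : Module.Dual ℝ N} (hℓ : ∀ x ∈ s, ℓ (ι x) = 1) (ha : IsAffineOn M fun x => ι x)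
    (hinj : Set.InjOn ι s) :
    M = linFun ι s ∧ (Topology.IsEmbedding fun x : s => ι x) ∧ IsPolyhedron (ι '' s) := by
  obtain ⟨L, hL⟩ := ha
  obtain ⟨e, he⟩ := hM.fullDimensional
  have hfd := hM.finiteDimensional
  have he1 : ∀ x : s, (e : C(s, ℝ)) x = 1 := fun x => by
    have : evalMap M x ∈ {n : Module.Dual ℝ M | n e = 1} :=
      he ▸ subset_affineSpan ℝ _ ⟨x, rfl⟩
    exact this
  have hle : ∀ ℓ' : Module.Dual ℝ N, ∃ m : M, ∀ x : s, (m : C(s, ℝ)) x = ℓ' (ι x) := by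
    intro ℓ'
    refine ⟨(Module.evalEquiv ℝ M).symm (ℓ' ∘ₗ L.linear) + ℓ' (L 0) • e, fun x => ?_⟩
    have h1 : ((Module.evalEquiv ℝ M).symm (ℓ' ∘ₗ L.linear) : C(s, ℝ)) x =
        ℓ' (L.linear (evalMap M x)) := by
      have := LinearMap.congr_fun ((Module.evalEquiv ℝ M).apply_symm_apply (ℓ' ∘ₗ L.linear))
        (evalMap M x)
      exact this
    have h2 : L (evalMap M x) = L.linear (evalMap M x) + L 0 := by
      rw [← sub_eq_iff_eq_add]
      have := L.linearMap_vsub (evalMap M x) 0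
      simpa only [vsub_eq_sub, sub_zero] using this.symm
    have h3 : ι x = _ := hL x
    rw [h3, h2, map_add]
    simp [h1, he1]
  have hc : Continuous fun x : s => ι x := by
    refine continuous_of_forall_dual fun ℓ' => ?_
    obtain ⟨m, hm⟩ := hle ℓ'
    exact (m : C(s, ℝ)).continuous.congr hm
  have hle' : linFun ι s ≤ M := by
    rintro m ⟨ℓ', h⟩
    obtain ⟨m', hm'⟩ := hle ℓ'
    have : m = m' := ContinuousMap.ext fun x => (h x).trans (hm' x).symm
    exact this ▸ m'.2
  have hconv : Convex ℝ (Set.range (evalMap M)) := hM.isPolyhedron.convex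
  have hge : M ≤ linFun ι s := by
    let W : Submodule ℝ M := (linFun ι s).comap M.subtype
    suffices hW : W = ⊤ by
      intro m hm
      have : (⟨m, hm⟩ : M) ∈ W := hW ▸ Submodule.mem_top
      exact this
    by_contra hne
    obtain ⟨n, hn0, hn⟩ := W.exists_le_ker_of_lt_top (lt_top_iff_ne_top.2 hne)
    have hspan := span_range_evalMap hfd
    have hn1 : ∀ (ℓ' : Module.Dual ℝ N) (m : M), (∀ x : s, (m : C(s, ℝ)) x = ℓ' (ι x)) → n m = 0 :=
      fun ℓ' m hm => hn (show m ∈ W from ⟨ℓ', hm⟩)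
    rcases (Set.range (evalMap M)).eq_empty_or_nonempty with h0 | h0
    · have : n ∈ Submodule.span ℝ (Set.range (evalMap M)) := hspan ▸ Submodule.mem_top
      rw [h0, Submodule.span_empty, Submodule.mem_bot] at this
      exact hn0 this
    obtain ⟨t, ht, _, ⟨x, rfl⟩, _, ⟨y, rfl⟩, hxy⟩ := exists_smul_sub_of_mem_span_of_eq_zero
      (ℓ := Module.evalEquiv ℝ M e) hconv h0 (by rintro _ ⟨x, rfl⟩; exact he1 x)
      (v := n) (hspan ▸ Submodule.mem_top) (hn1 ℓ e fun x => by rw [he1 x, hℓ x x.2])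
    rcases ht.eq_or_lt with rfl | ht
    · exact hn0 (by rw [hxy, zero_smul])
    have hι : ι x = ι y := by
      rw [← sub_eq_zero, ← Module.forall_dual_apply_eq_zero_iff ℝ]
      intro ℓ'
      obtain ⟨m, hm⟩ := hle ℓ'
      have h1 := hn1 ℓ' m hm
      rw [hxy] at h1
      have h2 : t * ((m : C(s, ℝ)) x - (m : C(s, ℝ)) y) = 0 := h1
      rw [hm, hm] at h2
      rw [map_sub]
      exact (mul_eq_zero.1 h2).resolve_left ht.ne'
    have : x = y := Subtype.ext (hinj x.2 y.2 hι)
    exact hn0 (by rw [hxy, this, sub_self, smul_zero])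
  have heq : M = linFun ι s := le_antisymm hge hle'
  subst heq
  refine ⟨rfl, ?_, ?_⟩
  · have hex : ∀ m : linFun ι s, ∃ ℓ' : Module.Dual ℝ N, ∀ x : s, (m : C(s, ℝ)) x = ℓ' (ι x) :=
      fun m => m.2
    choose φ hφ using hex
    refine Topology.IsEmbedding.of_comp (g := fun n m => φ m n) hc
      (continuous_pi fun m => (φ m).continuous_of_finiteDimensional) ?_
    convert hM.isEmbedding using 1
    ext x m
    exact (hφ m x).symm
  · rw [← image_range_evalMap hc]
    exact hM.isPolyhedron.image _ (dualToSpace_injective hc)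

end LinearFunctions

section Embedded

set_option linter.unusedSectionVars false

variable {X N : Type*} [TopologicalSpace X] [NormedAddCommGroup N] [InnerProductSpace ℝ N]

/-- A polyhedral structure described inside `N`: each polyhedron is embedded by `ι` as a polyhedron
in the hyperplane `ℓ = 1`, and its affine functions are the pullbacks of the linear ones. -/
structure IsEmbeddedStructure (ι : X → N) (ℓ : Module.Dual ℝ N) (K : PolyhedralStructure X) :
    Prop where
  eq_one : ∀ x, ℓ (ι x) = 1
  aff_eq : ∀ σ, K.aff σ = linFun ι (σ : Set X)
  isEmbedding : ∀ σ : K.polyhedra, Topology.IsEmbedding fun x : (σ : Set X) => ι x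
  isPolyhedron : ∀ σ : K.polyhedra, IsPolyhedron (ι '' σ)

variable [FiniteDimensional ℝ N] {ι : X → N} {ℓ : Module.Dual ℝ N} {K : PolyhedralStructure X}

theorem IsAdapted.isEmbeddedStructure (hK : IsAdapted ι K) (hℓ : ∀ x, ℓ (ι x) = 1) :
    IsEmbeddedStructure ι ℓ K := by
  have h := fun σ : K.polyhedra =>
    (K.chart σ).eq_linFun (fun x _ => hℓ x) (hK σ).1 (hK σ).2
  exact ⟨hℓ, fun σ => (h σ).1, fun σ => (h σ).2.1, fun σ => (h σ).2.2⟩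

namespace IsEmbeddedStructure

theorem injOn (h : IsEmbeddedStructure ι ℓ K) (σ : K.polyhedra) : Set.InjOn ι σ :=
  Set.injOn_iff_injective.2 (h.isEmbedding σ).injective

theorem convex (h : IsEmbeddedStructure ι ℓ K) (σ : K.polyhedra) : Convex ℝ (ι '' (σ : Set X)) :=
  (h.isPolyhedron σ).convex

theorem image_eq_one (h : IsEmbeddedStructure ι ℓ K) (s : Set X) : ∀ n ∈ ι '' s, ℓ n = 1 := by
  rintro _ ⟨x, -, rfl⟩; exact h.eq_one x

theorem isAdapted (h : IsEmbeddedStructure ι ℓ K) : IsAdapted ι K := by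
  intro σ
  refine ⟨?_, h.injOn σ⟩
  rw [h.aff_eq]
  exact ⟨(dualToSpace (h.isEmbedding σ).continuous).toAffineMap,
    fun x => (dualToSpace_evalMap (h.isEmbedding σ).continuous x).symm⟩

theorem isFaceOf_iff (h : IsEmbeddedStructure ι ℓ K) (σ : K.polyhedra) (t : Set X) :
    IsFaceOf (K.aff σ) t ↔ t ⊆ σ ∧ IsConvexFace (ι '' (σ : Set X)) (ι '' t) := by
  rw [h.aff_eq]
  exact isFaceOf_linFun_iff (h.isEmbedding σ).continuous

theorem dim_eq (h : IsEmbeddedStructure ι ℓ K) (σ : K.polyhedra) :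
    K.dim σ = (Module.finrank ℝ (Submodule.span ℝ (ι '' (σ : Set X))) : ℤ) - 1 := by
  rw [PolyhedralStructure.dim, h.aff_eq, finrank_linFun (h.isEmbedding σ).continuous]

theorem isConvexFace_inter (h : IsEmbeddedStructure ι ℓ K) (σ τ : K.polyhedra) :
    IsConvexFace (ι '' (σ : Set X)) (ι '' ((σ : Set X) ∩ τ)) :=
  ((h.isFaceOf_iff σ _).1 (K.inter_face σ τ).1).2

theorem exists_mem (K : PolyhedralStructure X) (x : X) : ∃ σ : K.polyhedra, x ∈ (σ : Set X) := by
  have : x ∈ ⋃₀ K.polyhedra := K.cover ▸ Set.mem_univ x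
  obtain ⟨σ, hσ, hx⟩ := this
  exact ⟨⟨σ, hσ⟩, hx⟩

theorem exists_face_of_isConvexFace (h : IsEmbeddedStructure ι ℓ K) (σ : K.polyhedra) {F : Set N}
    (hF : IsConvexFace (ι '' (σ : Set X)) F) :
    ∃ τ : K.polyhedra, K.Face τ σ ∧ ι '' (τ : Set X) = F := by
  have him : ι '' ((σ : Set X) ∩ ι ⁻¹' F) = F := by
    rw [Set.image_inter_preimage]; exact Set.inter_eq_self_of_subset_right hF.2.1
  have hface : IsFaceOf (K.aff σ) ((σ : Set X) ∩ ι ⁻¹' F) :=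
    (h.isFaceOf_iff σ _).2 ⟨Set.inter_subset_left, by rwa [him]⟩
  exact ⟨⟨_, (K.face_mem σ _ hface).1⟩, hface, him⟩

theorem exists_face_mem_relint (h : IsEmbeddedStructure ι ℓ K) (σ : K.polyhedra) {x : X}
    (hx : x ∈ (σ : Set X)) :
    ∃ τ : K.polyhedra, K.Face τ σ ∧ x ∈ (τ : Set X) ∧ ι x ∈ relint (ι '' (τ : Set X)) := by
  obtain ⟨F, hF, hxF⟩ := (h.isPolyhedron σ).exists_face (Set.mem_image_of_mem ι hx)
  obtain ⟨τ, hτ, rfl⟩ := h.exists_face_of_isConvexFace σ hF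
  obtain ⟨y, hy, hyx⟩ := hxF.1
  have : y = x := h.injOn σ (hτ.1 hy) hx hyx
  exact ⟨τ, hτ, this ▸ hy, hxF⟩

theorem exists_mem_relint (h : IsEmbeddedStructure ι ℓ K) (x : X) :
    ∃ τ : K.polyhedra, x ∈ (τ : Set X) ∧ ι x ∈ relint (ι '' (τ : Set X)) := by
  obtain ⟨σ, hσ⟩ := exists_mem K x
  obtain ⟨τ, -, hτ⟩ := h.exists_face_mem_relint σ hσ
  exact ⟨τ, hτ⟩

theorem subset_of_mem_relint (h : IsEmbeddedStructure ι ℓ K) (σ τ : K.polyhedra) {s : Set X}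
    (hs : s ⊆ σ) {x : X} (hx : x ∈ s) (hrel : ι x ∈ relint (ι '' s)) (hxτ : x ∈ (τ : Set X)) :
    s ⊆ τ := by
  have h1 := PolyhedralSpaces.subset_of_mem_relint (h.isConvexFace_inter σ τ).2 (Set.image_mono hs)
    hrel ⟨x, ⟨hs hx, hxτ⟩, rfl⟩
  intro y hy
  obtain ⟨z, hz, hzy⟩ := h1 ⟨y, hy, rfl⟩
  exact (h.injOn σ hz.1 (hs hy) hzy) ▸ hz.2

theorem eventually_exists_mem (h : IsEmbeddedStructure ι ℓ K) (σ : K.polyhedra) {x : X}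
    (hx : x ∈ (σ : Set X)) {O : Set X} (hO : O ∈ 𝓝 x) {v : N} {ε₀ : ℝ} (hε₀ : 0 < ε₀)
    (hv : ι x + ε₀ • v ∈ ι '' (σ : Set X)) :
    ∀ᶠ ε in 𝓝[>] (0 : ℝ), ∃ z ∈ (σ : Set X), z ∈ O ∧ ι z = ι x + ε • v := by
  have hO' : (fun z : (σ : Set X) => (z : X)) ⁻¹' O ∈ 𝓝 (⟨x, hx⟩ : (σ : Set X)) :=
    continuous_subtype_val.continuousAt.preimage_mem_nhds hO
  rw [(h.isEmbedding σ).nhds_eq_comap, Filter.mem_comap] at hO'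
  obtain ⟨B, hB, hBO⟩ := hO'
  have ht : Filter.Tendsto (fun ε : ℝ => ι x + ε • v) (𝓝[>] 0) (𝓝 (ι x)) := by
    have : Filter.Tendsto (fun ε : ℝ => ι x + ε • v) (𝓝 0) (𝓝 (ι x + (0 : ℝ) • v)) :=
      Continuous.tendsto (by fun_prop) 0
    rw [zero_smul, add_zero] at this
    exact this.mono_left nhdsWithin_le_nhds
  filter_upwards [ht hB, self_mem_nhdsWithin, mem_nhdsWithin_of_mem_nhds (Iio_mem_nhds hε₀)]
    with ε h1 h2 h3
  obtain ⟨z, hz, hzε⟩ := add_smul_mem_of_le (h.convex σ) (Set.mem_image_of_mem ι hx) hv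
    (le_of_lt h2) (le_of_lt h3)
  refine ⟨z, hz, ?_, hzε⟩
  have : (⟨z, hz⟩ : (σ : Set X)) ∈ (fun z : (σ : Set X) => (z : X)) ⁻¹' O :=
    hBO (show ι z ∈ B by rw [hzε]; exact h1)
  exact this

theorem eventually_mem_of_mem (K : PolyhedralStructure X) (x : X) :
    ∀ᶠ y in 𝓝 x, ∀ σ : K.polyhedra, y ∈ (σ : Set X) → x ∈ (σ : Set X) :=
  K.locallyFinite.eventually_subset (fun σ => K.isClosed σ σ.2) x

theorem exists_mem_relint_inter (h : IsEmbeddedStructure ι ℓ K) (σ : K.polyhedra)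
    {V : TopologicalSpace.Opens X} (hσ : σ ∈ K.restriction V) :
    ∃ x ∈ (σ : Set X), x ∈ V ∧ ι x ∈ relint (ι '' (σ : Set X)) := by
  obtain ⟨y, hy, hyV⟩ := hσ
  obtain ⟨_, hx⟩ := relint_nonempty (h.convex σ) ⟨_, Set.mem_image_of_mem ι hy⟩
  obtain ⟨x, hxσ, rfl⟩ := hx.1
  have h1 := h.eventually_exists_mem σ hy (V.isOpen.mem_nhds hyV) one_pos (v := ι x - ι y)
    ⟨x, hxσ, by simp⟩
  obtain ⟨ε, ⟨z, hz, hzV, hzε⟩, h2, h3⟩ := (h1.and (Filter.Eventually.and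
    self_mem_nhdsWithin (mem_nhdsWithin_of_mem_nhds (Iio_mem_nhds one_pos)))).exists
  refine ⟨z, hz, hzV, ?_⟩
  rw [hzε]
  exact lineMap_mem_relint (h.convex σ) hx (Set.mem_image_of_mem ι hy) h2 (le_of_lt h3)

theorem mem_PA_iff (h : IsEmbeddedStructure ι ℓ K) {V : TopologicalSpace.Opens X} {f : V → ℝ} :
    f ∈ K.PA V ↔ ∀ σ ∈ K.restriction V, ∃ p : Module.Dual ℝ N,
      ∀ (x : X) (hx : x ∈ V), x ∈ (σ : Set X) → f ⟨x, hx⟩ = p (ι x) := by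
  refine forall₂_congr fun σ _ => ?_
  constructor
  · rintro ⟨m, hm, hf⟩
    rw [h.aff_eq] at hm
    obtain ⟨p, hp⟩ := hm
    exact ⟨p, fun x hx hσ => (hf x hx hσ).trans (hp ⟨x, hσ⟩)⟩
  · rintro ⟨p, hp⟩
    refine ⟨linPullback (h.isEmbedding σ).continuous p, ?_, fun x hx hσ => hp x hx hσ⟩
    rw [h.aff_eq]
    exact (linPullback (h.isEmbedding σ).continuous p).2

theorem linearPart_spec (h : IsEmbeddedStructure ι ℓ K) {V : TopologicalSpace.Opens X} {f : V → ℝ}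
    (hf : f ∈ K.PA V) {σ : K.polyhedra} (hσ : σ ∈ K.restriction V) {x : X} (hx : x ∈ V)
    (hxσ : x ∈ (σ : Set X)) : f ⟨x, hx⟩ = linearPart ι f (σ : Set X) (ι x) :=
  Classical.epsilon_spec (p := fun p : Module.Dual ℝ N => ∀ (x : X) (hU : x ∈ V),
    x ∈ (σ : Set X) → f ⟨x, hU⟩ = p (ι x)) (h.mem_PA_iff.1 hf σ hσ) x hx hxσ

/-- Linear functions that agree on a nonempty relatively open part of a polyhedron agree on its
span. -/
theorem eq_of_eqOn_inter (h : IsEmbeddedStructure ι ℓ K) {V : TopologicalSpace.Opens X}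
    {σ : K.polyhedra} (hσ : σ ∈ K.restriction V) {p q : Module.Dual ℝ N}
    (hpq : ∀ x ∈ (σ : Set X), x ∈ V → p (ι x) = q (ι x)) {v : N}
    (hv : v ∈ Submodule.span ℝ (ι '' (σ : Set X))) : p v = q v := by
  obtain ⟨y, hy, hyV⟩ := hσ
  have : Submodule.span ℝ (ι '' (σ : Set X)) ≤ LinearMap.ker (p - q) := by
    rw [Submodule.span_le]
    rintro _ ⟨x, hx, rfl⟩
    have h1 := h.eventually_exists_mem σ hy (V.isOpen.mem_nhds hyV) one_pos (v := ι x - ι y)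
      ⟨x, hx, by simp⟩
    obtain ⟨ε, ⟨z, hz, hzV, hzε⟩, h2⟩ := (h1.and self_mem_nhdsWithin).exists
    have hε : ε ≠ 0 := ne_of_gt h2
    have e1 := hpq z hz hzV
    have e2 := hpq y hy hyV
    rw [hzε, map_add, map_add, map_smul, map_smul, map_sub, map_sub, e2, smul_eq_mul, smul_eq_mul,
      add_right_inj, mul_right_inj' hε, sub_left_inj] at e1
    simp [e1]
  have := this hv
  rwa [LinearMap.mem_ker, LinearMap.sub_apply, sub_eq_zero] at this

theorem subset_of_finrank_le (h : IsEmbeddedStructure ι ℓ K) {σ τ : K.polyhedra} {s : Set X}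
    (hne : s.Nonempty) (hsσ : s ⊆ σ) (hsτ : s ⊆ τ)
    (hle : Module.finrank ℝ (Submodule.span ℝ (ι '' (σ : Set X))) ≤
      Module.finrank ℝ (Submodule.span ℝ (ι '' s))) : (σ : Set X) ⊆ τ := by
  have hF := h.isConvexFace_inter σ τ
  have h1 : Submodule.span ℝ (ι '' s) = Submodule.span ℝ (ι '' (σ : Set X)) :=
    Submodule.eq_of_le_of_finrank_le (Submodule.span_mono (Set.image_mono hsσ)) hle
  have h2 : Submodule.span ℝ (ι '' (σ : Set X)) ≤
      Submodule.span ℝ (ι '' ((σ : Set X) ∩ τ)) := by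
    rw [← h1]
    exact Submodule.span_mono (Set.image_mono (Set.subset_inter hsσ hsτ))
  intro x hx
  obtain ⟨z, hz, hzx⟩ := mem_of_mem_span_of_isExtreme hF.2 hF.1
    (relint_nonempty hF.1 ((hne.mono (Set.subset_inter hsσ hsτ)).image ι))
    (h.image_eq_one _) (Set.mem_image_of_mem ι hx)
    (h2 (Submodule.subset_span (Set.mem_image_of_mem ι hx)))
  exact (h.injOn σ hz.1 hx hzx) ▸ hz.2

variable {K' : PolyhedralStructure X}

/-- A subdivision has a polyhedron of full dimension in every polyhedron, near every point. -/
theorem exists_subset_finrank_eq (h : IsEmbeddedStructure ι ℓ K) (h' : IsEmbeddedStructure ι ℓ K')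
    (hsub : K'.IsSubdivision K) (σ : K.polyhedra) {V : TopologicalSpace.Opens X}
    (hσ : σ ∈ K.restriction V) :
    ∃ σ' ∈ K'.restriction V, (σ' : Set X) ⊆ σ ∧
      Module.finrank ℝ (Submodule.span ℝ (ι '' (σ' : Set X))) =
        Module.finrank ℝ (Submodule.span ℝ (ι '' (σ : Set X))) := by
  have hsubset : ∀ x ∈ (σ : Set X), ∀ σ' : K'.polyhedra, x ∈ (σ' : Set X) →
      ι x ∈ relint (ι '' (σ' : Set X)) → (σ' : Set X) ⊆ σ := by
    intro x hx σ' hx' hrel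
    obtain ⟨σ₂, hσ₂, -⟩ := hsub σ'
    exact h.subset_of_mem_relint σ₂ σ hσ₂ hx' hrel hx
  have key : ∀ n ≤ Module.finrank ℝ (Submodule.span ℝ (ι '' (σ : Set X))),
      ∃ x ∈ (σ : Set X), x ∈ V ∧ ∃ σ' : K'.polyhedra, x ∈ (σ' : Set X) ∧
        ι x ∈ relint (ι '' (σ' : Set X)) ∧
        n ≤ Module.finrank ℝ (Submodule.span ℝ (ι '' (σ' : Set X))) := by
    intro n
    induction n with
    | zero =>
      intro _
      obtain ⟨x, hx, hxV⟩ := hσ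
      obtain ⟨σ', h1, h2⟩ := h'.exists_mem_relint x
      exact ⟨x, hx, hxV, σ', h1, h2, Nat.zero_le _⟩
    | succ n ih =>
      intro hn
      obtain ⟨x, hx, hxV, σ', h1, h2, h3⟩ := ih (by omega)
      rcases h3.lt_or_eq with h3 | h3
      · exact ⟨x, hx, hxV, σ', h1, h2, h3⟩
      have hnot : ¬ ι '' (σ : Set X) ⊆ Submodule.span ℝ (ι '' (σ' : Set X)) := by
        intro hcon
        have := Submodule.finrank_mono (Submodule.span_le.2 hcon)
        omega
      obtain ⟨_, ⟨y, hy, rfl⟩, hyn⟩ := Set.not_subset.1 hnot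
      have h4 := h.eventually_exists_mem σ hx (v := ι y - ι x) (ε₀ := 1)
        (Filter.inter_mem (V.isOpen.mem_nhds hxV) (eventually_mem_of_mem K' x)) one_pos
        ⟨y, hy, by simp⟩
      obtain ⟨ε, ⟨z, hz, ⟨hzV, hzx⟩, hzε⟩, hε⟩ := (h4.and self_mem_nhdsWithin).exists
      have hε : ε ≠ 0 := ne_of_gt hε
      obtain ⟨σ'', h5, h6⟩ := h'.exists_mem_relint z
      have hxσ'' := hzx σ'' h5
      have h7 : (σ' : Set X) ⊆ σ'' := h'.subset_of_mem_relint σ' σ'' subset_rfl h1 h2 hxσ''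
      refine ⟨z, hz, hzV, σ'', h5, h6, ?_⟩
      rw [h3]
      refine Nat.succ_le_of_lt (Submodule.finrank_lt_finrank_of_lt ?_)
      refine lt_of_le_of_ne (Submodule.span_mono (Set.image_mono h7)) fun heq => hyn ?_
      rw [heq]
      have hz' := Submodule.subset_span (R := ℝ) (Set.mem_image_of_mem ι h5)
      have hx' := Submodule.subset_span (R := ℝ) (Set.mem_image_of_mem ι hxσ'')
      have : ι y = ε⁻¹ • (ι z - ι x) + ι x := by
        rw [hzε, add_sub_cancel_left, smul_smul, inv_mul_cancel₀ hε, one_smul, sub_add_cancel]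
      rw [this]
      exact add_mem (Submodule.smul_mem _ _ (sub_mem hz' hx')) hx'
  obtain ⟨x, hx, hxV, σ', h1, h2, h3⟩ := key _ le_rfl
  have h4 := hsubset x hx σ' h1 h2
  exact ⟨σ', ⟨x, h1, hxV⟩, h4,
    le_antisymm (Submodule.finrank_mono (Submodule.span_mono (Set.image_mono h4))) h3⟩

theorem pullback_nonneg_iff (h : IsEmbeddedStructure ι ℓ K) (h' : IsEmbeddedStructure ι ℓ K')
    (hsub : K'.IsSubdivision K) {V : TopologicalSpace.Opens X} {k : ℤ} (c : K.Weight V k) :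
    (∀ σ', 0 ≤ PolyhedralStructure.pullback c K' σ') ↔ ∀ σ, 0 ≤ c σ := by
  classical
  constructor
  · intro hpos σ
    obtain ⟨σ', hσ', hss, hfr⟩ := h.exists_subset_finrank_eq h' hsub σ.1 σ.2.1
    have hdim : K'.dim σ' = k := by
      rw [h'.dim_eq, hfr, ← h.dim_eq]; exact σ.2.2
    have hex : ∃ σ : K.cells V k, (σ' : Set X) ⊆ (σ : K.polyhedra) := ⟨σ, hss⟩
    have heq : PolyhedralStructure.pullback c K' ⟨σ', hσ', hdim⟩ = c hex.choose := dif_pos hex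
    have hne : (σ' : Set X).Nonempty := hσ'.mono Set.inter_subset_left
    have hfr' : Module.finrank ℝ (Submodule.span ℝ (ι '' ((hex.choose : K.polyhedra) : Set X))) =
        Module.finrank ℝ (Submodule.span ℝ (ι '' (σ' : Set X))) := by
      have e1 := h.dim_eq hex.choose.1
      have e2 := h'.dim_eq σ'
      have e3 := hex.choose.2.2
      omega
    have : hex.choose = σ := Subtype.ext (Subtype.ext (Set.Subset.antisymm
      (h.subset_of_finrank_le hne hex.choose_spec hss hfr'.le)
      (h.subset_of_finrank_le hne hss hex.choose_spec hfr.ge)))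
    have := hpos ⟨σ', hσ', hdim⟩
    rw [heq] at this
    convert this using 2
    exact ‹hex.choose = σ›.symm
  · intro hpos σ'
    unfold PolyhedralStructure.pullback
    split_ifs
    · exact hpos _
    · exact le_rfl

end IsEmbeddedStructure

end Embedded

section Normals

set_option linter.unusedSectionVars false

variable {N : Type*} [NormedAddCommGroup N] [InnerProductSpace ℝ N] [FiniteDimensional ℝ N]

/-- `v` is a unit normal vector of `F` pointing into `C`. -/
def IsInnerNormal (F C : Set N) (v : N) : Prop :=
  ‖v‖ = 1 ∧ v ∈ (vectorSpan ℝ F)ᗮ ∧ v ∈ vectorSpan ℝ C ∧ ∀ a ∈ F, ∀ b ∈ C, 0 ≤ ⟪v, b - a⟫_ℝ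

theorem isUnitNormal_iff {X : Type*} (ι : X → N) (τ σ : Set X) (v : N) :
    IsUnitNormal ι τ σ v ↔ IsInnerNormal (ι '' τ) (ι '' σ) v := by
  simp only [IsUnitNormal, IsInnerNormal, Set.forall_mem_image]

/-- A nonempty convex face `F` of codimension `d` of a convex set `C` in the hyperplane `ℓ = 1`. -/
structure IsFaceOfCodim (ℓ : Module.Dual ℝ N) (d : ℕ) (C F : Set N) : Prop where
  face : IsConvexFace C F
  nonempty : F.Nonempty
  convex : Convex ℝ C
  eq_one : ∀ x ∈ C, ℓ x = 1
  finrank_eq : Module.finrank ℝ (Submodule.span ℝ C) = Module.finrank ℝ (Submodule.span ℝ F) + d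

namespace IsFaceOfCodim

variable {ℓ : Module.Dual ℝ N} {d : ℕ} {C F : Set N}

theorem subset (h : IsFaceOfCodim ℓ d C F) : F ⊆ C := h.face.2.1

theorem eq_one' (h : IsFaceOfCodim ℓ d C F) : ∀ x ∈ F, ℓ x = 1 := fun x hx => h.eq_one x (h.subset hx)

theorem relint_nonempty (h : IsFaceOfCodim ℓ d C F) : (relint F).Nonempty :=
  PolyhedralSpaces.relint_nonempty h.face.1 h.nonempty

theorem nonempty' (h : IsFaceOfCodim ℓ d C F) : C.Nonempty := h.nonempty.mono h.subset

theorem mem_vectorSpan (h : IsFaceOfCodim ℓ d C F) {v : N} :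
    v ∈ vectorSpan ℝ C ↔ v ∈ Submodule.span ℝ C ∧ ℓ v = 0 :=
  mem_vectorSpan_iff_mem_span h.eq_one h.nonempty'

theorem mem_vectorSpan' (h : IsFaceOfCodim ℓ d C F) {v : N} :
    v ∈ vectorSpan ℝ F ↔ v ∈ Submodule.span ℝ F ∧ ℓ v = 0 :=
  mem_vectorSpan_iff_mem_span h.eq_one' h.nonempty

theorem mem_of_sub_mem (h : IsFaceOfCodim ℓ d C F) {a b : N} (ha : a ∈ F) (hb : b ∈ C)
    (hab : b - a ∈ vectorSpan ℝ F) : b ∈ F := by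
  refine mem_of_mem_span_of_isExtreme h.face.2 h.face.1 h.relint_nonempty h.eq_one hb ?_
  have := add_mem (h.mem_vectorSpan'.1 hab).1 (Submodule.subset_span ha)
  rwa [sub_add_cancel] at this

theorem exists_notMem (h : IsFaceOfCodim ℓ d C F) (hd : 0 < d) : ∃ y ∈ C, y ∉ F := by
  by_contra! hcon
  have := Submodule.finrank_mono (Submodule.span_mono (R := ℝ) (show C ⊆ F from hcon))
  have := h.finrank_eq
  omega

theorem sub_inner_smul_mem (h : IsFaceOfCodim ℓ 1 C F) {v : N} (hv : ‖v‖ = 1)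
    (hvF : v ∈ (vectorSpan ℝ F)ᗮ) (hvC : v ∈ vectorSpan ℝ C) {z : N} (hz : z ∈ vectorSpan ℝ C) :
    z - ⟪v, z⟫_ℝ • v ∈ vectorSpan ℝ F := by
  have hvv : ⟪v, v⟫_ℝ = 1 := by rw [real_inner_self_eq_norm_sq, hv, one_pow]
  have hnot : v ∉ Submodule.span ℝ F := by
    intro hmem
    have h1 := (Submodule.mem_orthogonal _ _).1 hvF v
      (h.mem_vectorSpan'.2 ⟨hmem, (h.mem_vectorSpan.1 hvC).2⟩)
    rw [hvv] at h1
    exact one_ne_zero h1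
  have hle : Submodule.span ℝ F ⊔ Submodule.span ℝ {v} ≤ Submodule.span ℝ C :=
    sup_le (Submodule.span_mono h.subset)
      ((Submodule.span_singleton_le_iff_mem _ _).2 (h.mem_vectorSpan.1 hvC).1)
  have hlt : Submodule.span ℝ F < Submodule.span ℝ F ⊔ Submodule.span ℝ {v} := by
    refine lt_of_le_of_ne le_sup_left fun heq => hnot ?_
    rw [heq]
    exact Submodule.mem_sup_right (Submodule.mem_span_singleton_self v)
  have heq := Submodule.eq_of_le_of_finrank_le hle (by
    rw [h.finrank_eq]; exact Submodule.finrank_lt_finrank_of_lt hlt)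
  obtain ⟨hz1, hz0⟩ := h.mem_vectorSpan.1 hz
  rw [← heq] at hz1
  obtain ⟨s, hs, w, hw, rfl⟩ := Submodule.mem_sup.1 hz1
  obtain ⟨β, rfl⟩ := Submodule.mem_span_singleton.1 hw
  have hs0 : ℓ s = 0 := by
    rw [map_add, map_smul, (h.mem_vectorSpan.1 hvC).2, smul_zero, add_zero] at hz0
    exact hz0
  have hsF := h.mem_vectorSpan'.2 ⟨hs, hs0⟩
  have : ⟪v, s⟫_ℝ = 0 := (Submodule.mem_orthogonal' _ _).1 hvF s hsF
  rw [inner_add_right, this, inner_smul_right, hvv, zero_add, mul_one, add_sub_cancel_right]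
  exact hsF

theorem exists_isInnerNormal (h : IsFaceOfCodim ℓ 1 C F) : ∃ v, IsInnerNormal F C v := by
  obtain ⟨x, hx⟩ := h.nonempty
  obtain ⟨y, hy, hyF⟩ := h.exists_notMem one_pos
  set W := vectorSpan ℝ F with hW
  have hWC : W ≤ vectorSpan ℝ C := vectorSpan_mono ℝ h.subset
  set u := y - x - W.starProjection (y - x) with hu
  have huW : u ∈ Wᗮ := Submodule.sub_starProjection_mem_orthogonal _
  have hpW : W.starProjection (y - x) ∈ W := Submodule.starProjection_apply_mem _ _
  have hu0 : u ≠ 0 := by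
    intro h0
    refine hyF (h.mem_of_sub_mem hx hy ?_)
    rw [hu, sub_eq_zero] at h0
    rwa [h0]
  have hun : 0 < ‖u‖ := norm_pos_iff.2 hu0
  have huC : u ∈ vectorSpan ℝ C := sub_mem (vsub_mem_vectorSpan ℝ hy (h.subset hx)) (hWC hpW)
  set v := ‖u‖⁻¹ • u with hv
  have hv1 : ‖v‖ = 1 := by rw [hv, norm_smul, norm_inv, norm_norm, inv_mul_cancel₀ hun.ne']
  have hvW : v ∈ Wᗮ := Submodule.smul_mem _ _ huW
  have hvC : v ∈ vectorSpan ℝ C := Submodule.smul_mem _ _ huC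
  have hvy : 0 < ⟪v, y - x⟫_ℝ := by
    have h1 : ⟪u, W.starProjection (y - x)⟫_ℝ = 0 := (Submodule.mem_orthogonal' _ _).1 huW _ hpW
    have h2 : y - x = u + W.starProjection (y - x) := by rw [hu]; abel
    rw [h2, hv, inner_smul_left, inner_add_right, h1, add_zero, real_inner_self_eq_norm_sq]
    simp only [conj_trivial]; positivity
  refine ⟨v, hv1, hvW, hvC, fun a ha b hb => ?_⟩
  by_contra! hneg
  have hax : ⟪v, a - x⟫_ℝ = 0 :=
    (Submodule.mem_orthogonal' _ _).1 hvW _ (vsub_mem_vectorSpan ℝ ha hx)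
  have hbx : ⟪v, b - x⟫_ℝ < 0 := by
    have : b - x = (b - a) + (a - x) := by abel
    rw [this, inner_add_right, hax, add_zero]; exact hneg
  set α := ⟪v, y - x⟫_ℝ
  set β := ⟪v, b - x⟫_ℝ
  have hpos : 0 < α - β := by linarith
  have hsum : (-β) / (α - β) + α / (α - β) = 1 := by rw [← add_div, neg_add_eq_sub, div_self hpos.ne']
  have hq : (-β / (α - β)) • y + (α / (α - β)) • b ∈ C :=
    h.convex hy hb (div_nonneg (by linarith) hpos.le) (by positivity) hsum
  have hqF : (-β / (α - β)) • y + (α / (α - β)) • b ∈ F := by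
    refine h.mem_of_sub_mem hx hq ?_
    have h3 := h.sub_inner_smul_mem hv1 hvW hvC (vsub_mem_vectorSpan ℝ hq (h.subset hx))
    have h4 : (-β / (α - β)) • y + (α / (α - β)) • b - x =
        (-β / (α - β)) • (y - x) + (α / (α - β)) • (b - x) := by
      have : x = (-β / (α - β) + α / (α - β)) • x := by rw [hsum, one_smul]
      nth_rewrite 1 [this]; module
    have h5 : ⟪v, (-β / (α - β)) • y + (α / (α - β)) • b - x⟫_ℝ = 0 := by
      rw [h4, inner_add_right, inner_smul_right, inner_smul_right]
      change -β / (α - β) * α + α / (α - β) * β = 0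
      ring
    rwa [vsub_eq_sub, h5, zero_smul, sub_zero] at h3
  exact hyF (h.face.2.2 hy hb hqF ⟨_, _, div_pos (by linarith) hpos, div_pos hvy hpos, hsum, rfl⟩)

theorem mem_of_inner_eq_zero (h : IsFaceOfCodim ℓ 1 C F) {v : N} (hv : IsInnerNormal F C v) {a b : N}
    (ha : a ∈ F) (hb : b ∈ C) (h0 : ⟪v, b - a⟫_ℝ = 0) : b ∈ F := by
  refine h.mem_of_sub_mem ha hb ?_
  have := h.sub_inner_smul_mem hv.1 hv.2.1 hv.2.2.1 (vsub_mem_vectorSpan ℝ hb (h.subset ha))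
  rwa [vsub_eq_sub, h0, zero_smul, sub_zero] at this

/-- The inner normal at a relatively interior point of a facet points into the polyhedron. -/
theorem exists_add_smul_mem (h : IsFaceOfCodim ℓ 1 C F) {v : N} (hv : IsInnerNormal F C v) {x : N}
    (hx : x ∈ relint F) : ∃ ε : ℝ, 0 < ε ∧ x + ε • v ∈ C := by
  obtain ⟨y, hy, hyF⟩ := h.exists_notMem one_pos
  have hxC := h.subset hx.1
  have hα0 := hv.2.2.2 x hx.1 y hy
  have hα : 0 < ⟪v, y - x⟫_ℝ :=
    lt_of_le_of_ne hα0 fun h0 => hyF (h.mem_of_inner_eq_zero hv hx.1 hy h0.symm)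
  have hw := h.sub_inner_smul_mem hv.1 hv.2.1 hv.2.2.1 (vsub_mem_vectorSpan ℝ hy hxC)
  have hw' := h.mem_vectorSpan'.1 (neg_mem hw)
  obtain ⟨ε, hε, h1⟩ :=
    exists_add_smul_mem_of_mem_relint h.face.1 h.eq_one' hx hw'.1 hw'.2
  rw [vsub_eq_sub] at h1
  have hδ0 : 0 < min ε 1 := lt_min hε one_pos
  have h2 := add_smul_mem_of_le h.convex hxC (h.subset h1) hδ0.le (min_le_left _ _)
  have h3 : x + min ε 1 • (y - x) ∈ C :=
    add_smul_mem_of_le h.convex hxC (ε := 1) (by simpa using hy) hδ0.le (min_le_right _ _)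
  refine ⟨min ε 1 / 2 * ⟪v, y - x⟫_ℝ, by positivity, ?_⟩
  have := h.convex h2 h3 (a := 1 / 2) (b := 1 / 2) (by norm_num) (by norm_num) (by norm_num)
  convert this using 1
  module

theorem trans {R : Set N} {d' : ℕ} (h : IsFaceOfCodim ℓ d C F) (h' : IsFaceOfCodim ℓ d' F R) :
    IsFaceOfCodim ℓ (d' + d) C R :=
  ⟨⟨h'.face.1, h.face.2.trans h'.face.2⟩, h'.nonempty, h.convex, h.eq_one, by
    rw [h.finrank_eq, h'.finrank_eq, add_assoc]⟩

theorem eq_of_subset {F' : Set N} (h : IsFaceOfCodim ℓ d C F) (h' : IsFaceOfCodim ℓ d C F')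
    (hsub : F ⊆ F') : F = F' := by
  refine hsub.antisymm fun y hy => ?_
  refine mem_of_mem_span_of_isExtreme h.face.2 h.face.1 h.relint_nonempty h.eq_one (h'.subset hy) ?_
  have := Submodule.eq_of_le_of_finrank_le (Submodule.span_mono (R := ℝ) hsub) (by
    have := h.finrank_eq; have := h'.finrank_eq; omega)
  rw [this]
  exact Submodule.subset_span hy

end IsFaceOfCodim

variable {ℓ : Module.Dual ℝ N} {C F F' R : Set N}

/-- The plane of `C` orthogonal to a face `R` of codimension two has the orthonormal basis formed
by the normals of `R` in a facet `F` and of `F` in `C`. -/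
theorem eq_inner_smul_add_inner_smul (hF : IsFaceOfCodim ℓ 1 C F) (hR : IsFaceOfCodim ℓ 1 F R)
    {e n : N} (he : IsInnerNormal R F e) (hn : IsInnerNormal F C n) {z : N}
    (hz : z ∈ vectorSpan ℝ C) (hzR : z ∈ (vectorSpan ℝ R)ᗮ) :
    z = ⟪e, z⟫_ℝ • e + ⟪n, z⟫_ℝ • n := by
  have h1 := hF.sub_inner_smul_mem hn.1 hn.2.1 hn.2.2.1 hz
  have h2 := hR.sub_inner_smul_mem he.1 he.2.1 he.2.2.1 h1
  have hen : ⟪e, n⟫_ℝ = 0 := (Submodule.mem_orthogonal _ _).1 hn.2.1 e he.2.2.1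
  rw [inner_sub_right, inner_smul_right, hen, mul_zero, sub_zero] at h2
  have hnR : n ∈ (vectorSpan ℝ R)ᗮ :=
    Submodule.orthogonal_le (vectorSpan_mono ℝ hR.subset) hn.2.1
  have h3 : z - ⟪n, z⟫_ℝ • n - ⟪e, z⟫_ℝ • e ∈ (vectorSpan ℝ R)ᗮ :=
    sub_mem (sub_mem hzR (Submodule.smul_mem _ _ hnR)) (Submodule.smul_mem _ _ he.2.1)
  have h4 : z - ⟪n, z⟫_ℝ • n - ⟪e, z⟫_ℝ • e = 0 :=
    inner_self_eq_zero.1 ((Submodule.mem_orthogonal _ _).1 h3 _ h2)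
  rw [← sub_eq_zero, ← h4]
  abel

theorem inner_pos_of_ne (hF : IsFaceOfCodim ℓ 1 C F) (hR : IsFaceOfCodim ℓ 1 F R)
    (hF' : IsFaceOfCodim ℓ 1 C F') (hR' : IsFaceOfCodim ℓ 1 F' R) (hne : F ≠ F')
    {n e' : N} (hn : IsInnerNormal F C n) (he' : IsInnerNormal R F' e') : 0 < ⟪n, e'⟫_ℝ := by
  obtain ⟨x, hx⟩ := hR.relint_nonempty
  obtain ⟨ε, hε, h⟩ := hR'.exists_add_smul_mem he' hx
  have h1 := hn.2.2.2 x (hR.subset hx.1) _ (hF'.subset h)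
  rw [add_sub_cancel_left, inner_smul_right] at h1
  have h2 : 0 ≤ ⟪n, e'⟫_ℝ := nonneg_of_mul_nonneg_right h1 hε
  refine lt_of_le_of_ne h2 fun h0 => hne ?_
  have h3 : x + ε • e' ∈ F := hF.mem_of_inner_eq_zero hn (hR.subset hx.1) (hF'.subset h) (by
    rw [add_sub_cancel_left, inner_smul_right, ← h0, mul_zero])
  have h4 : e' ∈ vectorSpan ℝ F := by
    have := vsub_mem_vectorSpan ℝ h3 (hR.subset hx.1)
    rw [vsub_eq_sub, add_sub_cancel_left] at this
    rwa [Submodule.smul_mem_iff _ hε.ne'] at this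
  refine (hF'.eq_of_subset hF fun y hy => ?_).symm
  refine hF.mem_of_sub_mem (hR.subset hx.1) (hF'.subset hy) ?_
  have h5 := hR'.sub_inner_smul_mem he'.1 he'.2.1 he'.2.2.1
    (vsub_mem_vectorSpan ℝ hy (hR'.subset hx.1))
  have h6 := add_mem (vectorSpan_mono ℝ hR.subset h5)
    (Submodule.smul_mem _ ⟪e', y -ᵥ x⟫_ℝ h4)
  rwa [sub_add_cancel] at h6

theorem exists_rotation (hF : IsFaceOfCodim ℓ 1 C F) (hR : IsFaceOfCodim ℓ 1 F R)
    (hF' : IsFaceOfCodim ℓ 1 C F') (hR' : IsFaceOfCodim ℓ 1 F' R) (hne : F ≠ F')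
    {e n e' n' : N} (he : IsInnerNormal R F e) (hn : IsInnerNormal F C n)
    (he' : IsInnerNormal R F' e') (hn' : IsInnerNormal F' C n') :
    ∃ a b : ℝ, a ^ 2 + b ^ 2 = 1 ∧ e' = a • e + b • n ∧ n' = b • e - a • n := by
  have hb := inner_pos_of_ne hF hR hF' hR' hne hn he'
  have hc := inner_pos_of_ne hF' hR' hF hR hne.symm hn' he
  have e1 := eq_inner_smul_add_inner_smul hF hR he hn
    (vectorSpan_mono ℝ hF'.subset he'.2.2.1) he'.2.1
  have e2 := eq_inner_smul_add_inner_smul hF hR he hn hn'.2.2.1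
    (Submodule.orthogonal_le (vectorSpan_mono ℝ hR'.subset) hn'.2.1)
  rw [real_inner_comm] at hc
  set a := ⟪e, e'⟫_ℝ
  set b := ⟪n, e'⟫_ℝ
  set c := ⟪e, n'⟫_ℝ
  set d := ⟪n, n'⟫_ℝ
  have hen : ⟪e, n⟫_ℝ = 0 := (Submodule.mem_orthogonal _ _).1 hn.2.1 e he.2.2.1
  have hen' : ⟪e', n'⟫_ℝ = 0 := (Submodule.mem_orthogonal _ _).1 hn'.2.1 e' he'.2.2.1
  have hne0 : ⟪n, e⟫_ℝ = 0 := by rw [real_inner_comm, hen]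
  have hee : ⟪e, e⟫_ℝ = 1 := by rw [real_inner_self_eq_norm_sq, he.1, one_pow]
  have hnn : ⟪n, n⟫_ℝ = 1 := by rw [real_inner_self_eq_norm_sq, hn.1, one_pow]
  have hee' : ⟪e', e'⟫_ℝ = 1 := by rw [real_inner_self_eq_norm_sq, he'.1, one_pow]
  have hnn' : ⟪n', n'⟫_ℝ = 1 := by rw [real_inner_self_eq_norm_sq, hn'.1, one_pow]
  have expand : ∀ p q r s : ℝ, ⟪p • e + q • n, r • e + s • n⟫_ℝ = p * r + q * s := by
    intro p q r s
    simp only [inner_add_left, inner_add_right, inner_smul_left, inner_smul_right, hen, hne0, hee,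
      hnn, conj_trivial]
    ring
  rw [e1, expand] at hee'
  rw [e2, expand] at hnn'
  rw [e1, e2, expand] at hen'
  have hcb : c ^ 2 = b ^ 2 := by
    linear_combination (a * c - b * d) * hen' - c ^ 2 * hee' + b ^ 2 * hnn'
  have hcb' : c = b := by
    rcases sq_eq_sq_iff_eq_or_eq_neg.1 hcb with h | h
    · exact h
    · linarith
  have hda : d = -a := by
    rw [hcb'] at hen'
    have : b * (a + d) = 0 := by linear_combination hen'
    have := (mul_eq_zero.1 this).resolve_left hb.ne'
    linarith
  refine ⟨a, b, by linear_combination hee', e1, ?_⟩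
  rw [e2, hcb', hda]
  module

theorem eq_of_three_facets {F'' : Set N} (hF : IsFaceOfCodim ℓ 1 C F) (hR : IsFaceOfCodim ℓ 1 F R)
    (hF' : IsFaceOfCodim ℓ 1 C F') (hR' : IsFaceOfCodim ℓ 1 F' R)
    (hF'' : IsFaceOfCodim ℓ 1 C F'') (hR'' : IsFaceOfCodim ℓ 1 F'' R) (hne : F ≠ F') :
    F'' = F ∨ F'' = F' := by
  by_contra! hcon
  obtain ⟨e, he⟩ := hR.exists_isInnerNormal
  obtain ⟨n, hn⟩ := hF.exists_isInnerNormal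
  obtain ⟨e', he'⟩ := hR'.exists_isInnerNormal
  obtain ⟨n', hn'⟩ := hF'.exists_isInnerNormal
  obtain ⟨e'', he''⟩ := hR''.exists_isInnerNormal
  obtain ⟨n'', hn''⟩ := hF''.exists_isInnerNormal
  obtain ⟨a, b, -, h1, h2⟩ := exists_rotation hF hR hF' hR' hne he hn he' hn'
  obtain ⟨c, d, -, h3, h4⟩ := exists_rotation hF hR hF'' hR'' hcon.1.symm he hn he'' hn''
  have h5 := inner_pos_of_ne hF' hR' hF'' hR'' hcon.2.symm hn' he''
  have h6 := inner_pos_of_ne hF'' hR'' hF' hR' hcon.2 hn'' he'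
  have hen : ⟪e, n⟫_ℝ = 0 := (Submodule.mem_orthogonal _ _).1 hn.2.1 e he.2.2.1
  have hne0 : ⟪n, e⟫_ℝ = 0 := by rw [real_inner_comm, hen]
  have hee : ⟪e, e⟫_ℝ = 1 := by rw [real_inner_self_eq_norm_sq, he.1, one_pow]
  have hnn : ⟪n, n⟫_ℝ = 1 := by rw [real_inner_self_eq_norm_sq, hn.1, one_pow]
  rw [h2, h3] at h5
  rw [h4, h1] at h6
  simp only [inner_add_right, inner_sub_left, inner_smul_left, inner_smul_right, hen, hne0, hee,
      hnn, conj_trivial] at h5 h6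
  linarith

theorem apply_normal_smul_add (hF : IsFaceOfCodim ℓ 1 C F) (hR : IsFaceOfCodim ℓ 1 F R)
    (hF' : IsFaceOfCodim ℓ 1 C F') (hR' : IsFaceOfCodim ℓ 1 F' R) (hne : F ≠ F')
    {e n e' n' : N} (he : IsInnerNormal R F e) (hn : IsInnerNormal F C n)
    (he' : IsInnerNormal R F' e') (hn' : IsInnerNormal F' C n') (f : Module.Dual ℝ N) :
    f n • e + f n' • e' = f e • n + f e' • n' := by
  obtain ⟨a, b, hab, rfl, rfl⟩ := exists_rotation hF hR hF' hR' hne he hn he' hn'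
  simp only [map_add, map_sub, map_smul, smul_eq_mul]
  have : b ^ 2 = 1 - a ^ 2 := by linear_combination hab
  rw [← sub_eq_zero]
  calc _ = (f n * (1 - a ^ 2 - b ^ 2)) • e + (f e * (b ^ 2 - 1 + a ^ 2)) • n := by module
    _ = 0 := by rw [this]; simp

/-- Rotating a direction away from an interior direction `w`, one hits a facet. -/
theorem exists_facet (hP : IsPolyhedron C) (hR : IsFaceOfCodim ℓ 2 C R) {x y u : N}
    (hx : x ∈ relint R) (hy : y ∈ relint C) (hu : u ∈ vectorSpan ℝ C)
    (hind : ∀ s : ℝ, u + s • (y - x) ∉ vectorSpan ℝ R) :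
    ∃ s : ℝ, (∃ ε : ℝ, 0 < ε ∧ x + ε • (u + s • (y - x)) ∈ C) ∧
      ∃ F, IsFaceOfCodim ℓ 1 C F ∧ IsFaceOfCodim ℓ 1 F R ∧ u + s • (y - x) ∈ vectorSpan ℝ F := by
  have hxC : x ∈ C := hR.subset hx.1
  have hyR : y ∉ R := fun hyR => by
    obtain ⟨c, hc, hcR⟩ := hR.exists_notMem two_pos
    exact hcR (subset_of_mem_relint hR.face.2 subset_rfl hy hyR hc)
  obtain ⟨S, hS⟩ := id hP
  have hmem : ∀ z, z ∈ C ↔ ∀ p ∈ S, p.1 z ≤ p.2 := fun z => by rw [hS]; rfl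
  have enter : ∀ z, (∀ p ∈ S, p.1 x = p.2 → p.1 z ≤ 0) → ∃ ε : ℝ, 0 < ε ∧ x + ε • z ∈ C := by
    intro z hz
    have key : ∀ p ∈ S, ∀ᶠ ε in 𝓝[>] (0 : ℝ), p.1 (x + ε • z) ≤ p.2 := by
      intro p hp
      rcases ((hmem x).1 hxC p hp).eq_or_lt with h | h
      · filter_upwards [self_mem_nhdsWithin] with ε hε
        have := mul_nonpos_of_nonneg_of_nonpos (le_of_lt hε) (hz p hp h)
        rw [map_add, map_smul, smul_eq_mul]; linarith
      · have : Filter.Tendsto (fun ε : ℝ => p.1 x + ε * p.1 z) (𝓝[>] 0)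
            (𝓝 (p.1 x + 0 * p.1 z)) := by
          refine Filter.Tendsto.mono_left ?_ nhdsWithin_le_nhds
          exact Continuous.tendsto (by fun_prop) 0
        rw [zero_mul, add_zero] at this
        filter_upwards [this.eventually_lt_const h] with ε hε
        simpa using hε.le
    obtain ⟨ε, h1, h2⟩ :=
      (((Filter.eventually_all_finset S).2 key).and self_mem_nhdsWithin).exists
    exact ⟨ε, h2, (hmem _).2 h1⟩
  classical
  set B := S.filter fun p => p.1 x = p.2 ∧ p.1 (y - x) < 0 with hB
  have hle : ∀ p ∈ S, p.1 x = p.2 → p.1 (y - x) ≤ 0 := fun p hp hpx => by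
    rw [map_sub, hpx, sub_nonpos]; exact (hmem y).1 hy.1 p hp
  have hBne : B.Nonempty := by
    by_contra hcon
    rw [Finset.not_nonempty_iff_eq_empty, Finset.filter_eq_empty_iff] at hcon
    obtain ⟨ε, hε, h⟩ := enter (x - y) fun p hp hpx => by
      have h1 := hcon hp
      rw [not_and, not_lt] at h1
      have h2 := h1 hpx
      rw [map_sub] at h2 ⊢
      linarith
    exact hyR (hR.face.2.2 hy.1 h hx.1 (mem_openSegment_prolong x y hε))
  obtain ⟨q, hq, hmax⟩ := B.exists_max_image (fun p => p.1 u / (-p.1 (y - x))) hBne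
  obtain ⟨hqS, hqx, hqw⟩ := Finset.mem_filter.1 hq
  set s := q.1 u / (-q.1 (y - x)) with hs
  set e := u + s • (y - x) with he
  have heC : e ∈ vectorSpan ℝ C :=
    add_mem hu (Submodule.smul_mem _ _ (vsub_mem_vectorSpan ℝ hy.1 hxC))
  have hqe : q.1 e = 0 := by
    rw [he, map_add, map_smul, smul_eq_mul, hs, div_neg, neg_mul, div_mul_cancel₀ _ hqw.ne,
      add_neg_cancel]
  obtain ⟨ε, hε, hεC⟩ := enter e fun p hp hpx => by
    rw [he, map_add, map_smul, smul_eq_mul]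
    rcases (hle p hp hpx).eq_or_lt with h | h
    · obtain ⟨hu1, hu0⟩ := hR.mem_vectorSpan.1 hu
      obtain ⟨δ, hδ, h2⟩ := exists_add_smul_mem_of_mem_relint hR.convex hR.eq_one hy hu1 hu0
      have h3 := (hmem _).1 h2 p hp
      have h4 : p.1 y = p.2 := by rw [map_sub, hpx, sub_eq_zero] at h; exact h
      rw [map_add, map_smul, h4, smul_eq_mul] at h3
      have : p.1 u ≤ 0 := by
        by_contra! hpos
        have := mul_pos hδ hpos
        linarith
      rw [h, mul_zero, add_zero]; exact this
    · have h1 := hmax p (Finset.mem_filter.2 ⟨hp, hpx, h⟩)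
      rw [div_le_iff₀ (by linarith)] at h1
      linarith
  refine ⟨s, ⟨ε, hε, hεC⟩, ?_⟩
  have hz : x + (ε / 2) • e ∈ C := add_smul_mem_of_le hR.convex hxC hεC (by positivity) (by linarith)
  obtain ⟨F, hF, hzF⟩ := hP.exists_face hz
  have hxF : x ∈ F := hF.2.2 hxC hεC hzF.1
    ⟨1 / 2, 1 / 2, by norm_num, by norm_num, by norm_num, by module⟩
  have hRF : R ⊆ F := subset_of_mem_relint hF.2 hR.subset hx hxF
  have heF : e ∈ vectorSpan ℝ F := by
    have := vsub_mem_vectorSpan ℝ hzF.1 hxF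
    rw [vsub_eq_sub, add_sub_cancel_left] at this
    rwa [Submodule.smul_mem_iff _ (by positivity)] at this
  have hyF : y ∉ F := by
    intro hyF
    obtain ⟨δ, hδ, h⟩ := hzF.2 y hyF
    have h1 := (hmem _).1 (hF.2.1 h) q hqS
    have h2 : 0 < δ * -q.1 (y - x) := mul_pos hδ (by linarith)
    have h3 : q.1 (x + (ε / 2) • e + δ • (x + (ε / 2) • e - y)) = q.2 + δ * -q.1 (y - x) := by
      simp only [map_add, map_sub, map_smul, hqe, hqx, smul_eq_mul]; ring
    linarith
  have hFeq : ∀ x ∈ F, ℓ x = 1 := fun x hx => hR.eq_one x (hF.2.1 hx)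
  obtain ⟨heF1, heF0⟩ := (mem_vectorSpan_iff_mem_span hFeq ⟨x, hxF⟩).1 heF
  have hlt1 : Submodule.span ℝ R < Submodule.span ℝ F := by
    refine lt_of_le_of_ne (Submodule.span_mono hRF) fun heq => hind s ?_
    rw [← he, hR.mem_vectorSpan', heq]
    exact ⟨heF1, heF0⟩
  have hlt2 : Submodule.span ℝ F < Submodule.span ℝ C := by
    refine lt_of_le_of_ne (Submodule.span_mono hF.2.1) fun heq => hyF ?_
    refine mem_of_mem_span_of_isExtreme hF.2 hF.1 ⟨_, hzF⟩ hR.eq_one hy.1 ?_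
    rw [heq]
    exact Submodule.subset_span hy.1
  have h1 := Submodule.finrank_lt_finrank_of_lt hlt1
  have h2 := Submodule.finrank_lt_finrank_of_lt hlt2
  have h3 := hR.finrank_eq
  exact ⟨F, ⟨hF, ⟨x, hxF⟩, hR.convex, hR.eq_one, by omega⟩,
    ⟨⟨hR.face.1, hR.face.2.mono hF.2.1 hRF⟩, hR.nonempty, hF.1, hFeq, by omega⟩, heF⟩

theorem exists_two_facets (hP : IsPolyhedron C) (hR : IsFaceOfCodim ℓ 2 C R) :
    ∃ F F', F ≠ F' ∧ IsFaceOfCodim ℓ 1 C F ∧ IsFaceOfCodim ℓ 1 F R ∧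
      IsFaceOfCodim ℓ 1 C F' ∧ IsFaceOfCodim ℓ 1 F' R := by
  obtain ⟨x, hx⟩ := hR.relint_nonempty
  obtain ⟨y, hy⟩ := relint_nonempty hR.convex hR.nonempty'
  have hxC := hR.subset hx.1
  have hex : ∃ u ∈ vectorSpan ℝ C, ∀ s : ℝ, u + s • (y - x) ∉ vectorSpan ℝ R := by
    by_contra! hcon
    have hle : Submodule.span ℝ C ≤ Submodule.span ℝ R ⊔ Submodule.span ℝ {y} := by
      rw [Submodule.span_le]
      intro c hc
      obtain ⟨s, hs⟩ := hcon (c - x) (vsub_mem_vectorSpan ℝ hc hxC)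
      have h1 := Submodule.subset_span (R := ℝ) hx.1
      have h2 : c = ((c - x + s • (y - x)) + (1 + s) • x) + (-s) • y := by module
      rw [SetLike.mem_coe, h2]
      exact Submodule.add_mem_sup (add_mem (hR.mem_vectorSpan'.1 hs).1 (Submodule.smul_mem _ _ h1))
        (Submodule.smul_mem _ _ (Submodule.mem_span_singleton_self y))
    have h1 := Submodule.finrank_mono hle
    have h2 := Submodule.finrank_add_le_finrank_add_finrank (Submodule.span ℝ R)
      (Submodule.span ℝ {y})
    have h3 := finrank_span_le_card (R := ℝ) ({y} : Set N)
    have h4 := hR.finrank_eq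
    simp at h3
    omega
  obtain ⟨u, hu, hind⟩ := hex
  obtain ⟨s, ⟨ε, hε, hεC⟩, F, hF, hRF, heF⟩ := exists_facet hP hR hx hy hu hind
  obtain ⟨s', ⟨ε', hε', hεC'⟩, F', hF', hRF', heF'⟩ := exists_facet hP hR hx hy (neg_mem hu)
    fun s hs => hind (-s) (by
      have := neg_mem hs
      convert this using 1; module)
  refine ⟨F, F', ?_, hF, hRF, hF', hRF'⟩
  rintro rfl
  by_cases h0 : s + s' = 0
  · refine hind s ?_
    have hs' : s' = -s := by linarith
    subst hs'
    have h1 : x + ε • (u + s • (y - x)) ∈ R := by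
      refine hR.face.2.2 hεC hεC' hx.1 ⟨ε' / (ε + ε'), ε / (ε + ε'), by positivity, by positivity,
        by rw [← add_div, add_comm, div_self (by positivity)], ?_⟩
      have h2 : ε' / (ε + ε') + ε / (ε + ε') = 1 := by
        rw [← add_div, add_comm, div_self (by positivity)]
      have h3 : ε' / (ε + ε') * ε = ε / (ε + ε') * ε' := by ring
      calc _ = (ε' / (ε + ε') + ε / (ε + ε')) • x + (ε' / (ε + ε') * ε - ε / (ε + ε') * ε') •
            (u + s • (y - x)) := by module
        _ = x := by rw [h2, h3, sub_self, one_smul, zero_smul, add_zero]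
    have := vsub_mem_vectorSpan ℝ h1 hx.1
    rw [vsub_eq_sub, add_sub_cancel_left] at this
    rwa [Submodule.smul_mem_iff _ hε.ne'] at this
  · have h1 : y - x ∈ vectorSpan ℝ F := by
      have := add_mem heF heF'
      rw [show u + s • (y - x) + (-u + s' • (y - x)) = (s + s') • (y - x) by module,
        Submodule.smul_mem_iff _ h0] at this
      exact this
    have h2 := hF.mem_of_sub_mem (hRF.subset hx.1) hy.1 h1
    obtain ⟨c, hc, hcF⟩ := hF.exists_notMem one_pos
    exact hcF (subset_of_mem_relint hF.face.2 subset_rfl hy h2 hc)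

end Normals

section Products

set_option linter.unusedSectionVars false

variable {X N : Type*} [TopologicalSpace X] [NormedAddCommGroup N] [InnerProductSpace ℝ N]
  [FiniteDimensional ℝ N] {ι : X → N} {ℓ : Module.Dual ℝ N} {K : PolyhedralStructure X}
  {V : TopologicalSpace.Opens X} {k : ℤ}

namespace IsEmbeddedStructure

theorem isFaceOfCodim (h : IsEmbeddedStructure ι ℓ K) {τ σ : K.polyhedra} (hface : K.Face τ σ)
    (hne : (τ : Set X).Nonempty) {d : ℕ} (hd : K.dim σ = K.dim τ + d) :
    IsFaceOfCodim ℓ d (ι '' (σ : Set X)) (ι '' (τ : Set X)) :=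
  ⟨((h.isFaceOf_iff σ _).1 hface).2, hne.image ι, h.convex σ, h.image_eq_one _, by
    rw [h.dim_eq, h.dim_eq] at hd; omega⟩

theorem face_of_isFaceOfCodim (h : IsEmbeddedStructure ι ℓ K) {τ σ : K.polyhedra} {d : ℕ}
    (hsub : (τ : Set X) ⊆ σ) (hd : IsFaceOfCodim ℓ d (ι '' (σ : Set X)) (ι '' (τ : Set X))) :
    K.Face τ σ :=
  (h.isFaceOf_iff σ _).2 ⟨hsub, hd.face⟩

theorem cell_isFaceOfCodim (h : IsEmbeddedStructure ι ℓ K) {τ : K.cells V (k - 1)}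
    {σ : K.cells V k} (hface : K.Face τ σ) :
    IsFaceOfCodim ℓ 1 (ι '' ((σ : K.polyhedra) : Set X)) (ι '' ((τ : K.polyhedra) : Set X)) :=
  h.isFaceOfCodim hface (τ.2.1.mono Set.inter_subset_left) (by
    rw [σ.2.2, τ.2.2]; simp)

theorem isInnerNormal_unitNormal {τ σ : Set X} (h : IsFaceOfCodim ℓ 1 (ι '' σ) (ι '' τ)) :
    IsInnerNormal (ι '' τ) (ι '' σ) (unitNormal ι τ σ) := by
  rw [← isUnitNormal_iff]
  refine Classical.epsilon_spec (p := IsUnitNormal ι τ σ) ?_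
  obtain ⟨v, hv⟩ := h.exists_isInnerNormal
  exact ⟨v, (isUnitNormal_iff ι τ σ v).2 hv⟩

end IsEmbeddedStructure

theorem PolyhedralStructure.finite_cells_mem (K : PolyhedralStructure X)
    (V : TopologicalSpace.Opens X) (k : ℤ) (x : X) :
    {σ : K.cells V k | x ∈ ((σ : K.polyhedra) : Set X)}.Finite :=
  (K.locallyFinite.point_finite x).preimage (f := fun σ : K.cells V k => (σ : K.polyhedra))
    Subtype.val_injective.injOn

open Classical in
theorem PolyhedralStructure.finsum_face_eq {A : Type*} [AddCommGroup A] {τ : K.polyhedra} {x : X}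
    (hx : x ∈ (τ : Set X)) (g : K.cells V k → A) :
    ∑ᶠ (σ : K.cells V k) (_ : K.Face τ σ), g σ =
      ∑ σ ∈ (K.finite_cells_mem V k x).toFinset, if K.Face τ σ then g σ else 0 := by
  rw [← finsum_eq_sum_of_support_subset]
  · exact finsum_congr fun σ => finsum_eq_if
  · intro σ hσ
    have : K.Face τ σ := by
      by_contra hcon
      simp [hcon] at hσ
    simpa using this.1 hx

namespace IsEmbeddedStructure

open Classical in
/-- In a polyhedron with a face `ρ` of codimension two, the contributions of the two facets that
contain `ρ` are exchanged. -/
theorem sum_facets_eq (h : IsEmbeddedStructure ι ℓ K) {ρ : K.cells V (k - 1 - 1)}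
    (σ : K.cells V k) {x : X} (hx : x ∈ ((ρ : K.polyhedra) : Set X)) (p : Module.Dual ℝ N) :
    ∑ τ ∈ (K.finite_cells_mem V (k - 1) x).toFinset, (if K.Face ρ τ ∧ K.Face τ σ then
      p (unitNormal ι (τ : K.polyhedra) (σ : K.polyhedra)) •
        unitNormal ι (ρ : K.polyhedra) (τ : K.polyhedra) else 0) =
    ∑ τ ∈ (K.finite_cells_mem V (k - 1) x).toFinset, (if K.Face ρ τ ∧ K.Face τ σ then
      p (unitNormal ι (ρ : K.polyhedra) (τ : K.polyhedra)) •
        unitNormal ι (τ : K.polyhedra) (σ : K.polyhedra) else 0) := by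
  rw [← Finset.sum_filter, ← Finset.sum_filter]
  set T := (K.finite_cells_mem V (k - 1) x).toFinset.filter
    fun τ : K.cells V (k - 1) => K.Face ρ τ ∧ K.Face τ σ with hT
  have hmemT : ∀ τ : K.cells V (k - 1), τ ∈ T ↔ K.Face ρ τ ∧ K.Face τ σ := by
    intro τ
    rw [hT, Finset.mem_filter]
    refine ⟨fun h => h.2, fun h => ⟨?_, h⟩⟩
    simpa using h.1.1 hx
  rcases T.eq_empty_or_nonempty with h0 | ⟨τ₀, hτ₀⟩
  · simp [h0]
  obtain ⟨h1, h2⟩ := (hmemT τ₀).1 hτ₀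
  have hR : IsFaceOfCodim ℓ 2 (ι '' ((σ : K.polyhedra) : Set X)) (ι '' ((ρ : K.polyhedra) : Set X)) :=
    (h.cell_isFaceOfCodim h2).trans (h.cell_isFaceOfCodim h1)
  have hρσ : ((ρ : K.polyhedra) : Set X) ⊆ (σ : K.polyhedra) := h1.1.trans h2.1
  obtain ⟨F, F', hne, hF, hRF, hF', hRF'⟩ := exists_two_facets (h.isPolyhedron σ) hR
  have hlift : ∀ F, IsFaceOfCodim ℓ 1 (ι '' ((σ : K.polyhedra) : Set X)) F →
      IsFaceOfCodim ℓ 1 F (ι '' ((ρ : K.polyhedra) : Set X)) →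
      ∃ τ : K.cells V (k - 1), K.Face ρ τ ∧ K.Face τ σ ∧ ι '' ((τ : K.polyhedra) : Set X) = F := by
    intro F hF hRF
    obtain ⟨τ, hτ, rfl⟩ := h.exists_face_of_isConvexFace σ hF.face
    have hsub : ((ρ : K.polyhedra) : Set X) ⊆ τ := by
      intro y hy
      obtain ⟨z, hz, hzy⟩ := hRF.subset (Set.mem_image_of_mem ι hy)
      exact (h.injOn σ (hτ.1 hz) (hρσ hy) hzy) ▸ hz
    refine ⟨⟨τ, ?_, ?_⟩, h.face_of_isFaceOfCodim hsub hRF, hτ, rfl⟩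
    · obtain ⟨y, hy, hyV⟩ := ρ.2.1
      exact ⟨y, hsub hy, hyV⟩
    · have e1 := σ.2.2
      have e2 := hF.finrank_eq
      rw [h.dim_eq] at e1 ⊢
      push_cast [e2] at e1
      linarith
  have hinj : ∀ τ τ' : K.cells V (k - 1), K.Face τ σ → K.Face τ' σ →
      ι '' ((τ : K.polyhedra) : Set X) = ι '' ((τ' : K.polyhedra) : Set X) → τ = τ' := by
    intro τ τ' hτ hτ' heq
    exact Subtype.ext (Subtype.ext ((h.injOn σ).image_eq_image_iff hτ.1 hτ'.1 |>.1 heq))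
  obtain ⟨τ, hρτ, hτσ, rfl⟩ := hlift F hF hRF
  obtain ⟨τ', hρτ', hτσ', rfl⟩ := hlift F' hF' hRF'
  have hne' : τ ≠ τ' := fun heq => hne (by rw [heq])
  have hTeq : T = {τ, τ'} := by
    ext τ''
    rw [hmemT, Finset.mem_insert, Finset.mem_singleton]
    constructor
    · rintro ⟨h3, h4⟩
      exact (eq_of_three_facets hF hRF hF' hRF' (h.cell_isFaceOfCodim h4) (h.cell_isFaceOfCodim h3)
        hne).imp (hinj _ _ h4 hτσ) (hinj _ _ h4 hτσ')
    · rintro (rfl | rfl)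
      exacts [⟨hρτ, hτσ⟩, ⟨hρτ', hτσ'⟩]
  rw [hTeq, Finset.sum_pair hne', Finset.sum_pair hne']
  exact apply_normal_smul_add hF hRF hF' hRF' hne (isInnerNormal_unitNormal hRF)
    (isInnerNormal_unitNormal hF) (isInnerNormal_unitNormal hRF') (isInnerNormal_unitNormal hF') p

theorem linearPart_eq (h : IsEmbeddedStructure ι ℓ K) {f : V → ℝ} (hf : f ∈ K.PA V)
    {τ σ : K.polyhedra} (hτ : τ ∈ K.restriction V) (hσ : σ ∈ K.restriction V)
    (hsub : (τ : Set X) ⊆ σ) {v : N} (hv : v ∈ Submodule.span ℝ (ι '' (τ : Set X))) :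
    linearPart ι f (σ : Set X) v = linearPart ι f (τ : Set X) v := by
  refine h.eq_of_eqOn_inter hτ (fun x hx hxV => ?_) hv
  rw [← h.linearPart_spec hf hσ hxV (hsub hx), ← h.linearPart_spec hf hτ hxV hx]

/-- The product of a piecewise affine function with a Minkowski weight is a Minkowski weight. -/
theorem isMinkowski_prod (h : IsEmbeddedStructure ι ℓ K) {f : V → ℝ} (hf : f ∈ K.PA V)
    {c : K.Weight V k} (hc : PolyhedralStructure.IsMinkowski ι c) :
    PolyhedralStructure.IsMinkowski ι (PolyhedralStructure.prod ι f c) := by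
  classical
  intro ρ
  obtain ⟨x, hx, hxV⟩ := ρ.2.1
  rw [PolyhedralStructure.finsum_face_eq hx]
  set T := (K.finite_cells_mem V (k - 1) x).toFinset
  set S := (K.finite_cells_mem V k x).toFinset
  have step1 : ∀ τ ∈ T, (if K.Face ρ τ then PolyhedralStructure.prod ι f c τ •
      unitNormal ι (ρ : K.polyhedra) (τ : K.polyhedra) else 0) =
      -∑ σ ∈ S, c σ • (if K.Face ρ τ ∧ K.Face τ σ then
        linearPart ι f (σ : K.polyhedra) (unitNormal ι (τ : K.polyhedra) (σ : K.polyhedra)) •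
          unitNormal ι (ρ : K.polyhedra) (τ : K.polyhedra) else 0) := by
    intro τ _
    split_ifs with hρτ
    · rw [PolyhedralStructure.prod, PolyhedralStructure.finsum_face_eq (hρτ.1 hx), neg_smul,
        Finset.sum_smul]
      refine congrArg _ (Finset.sum_congr rfl fun σ _ => ?_)
      by_cases hτσ : K.Face τ σ
      · simp [hρτ, hτσ, smul_smul]
      · simp [hτσ]
    · simp [hρτ]
  have step2 : ∀ τ ∈ T, ∑ σ ∈ S, c σ • (if K.Face ρ τ ∧ K.Face τ σ then
        linearPart ι f (σ : K.polyhedra) (unitNormal ι (ρ : K.polyhedra) (τ : K.polyhedra)) •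
          unitNormal ι (τ : K.polyhedra) (σ : K.polyhedra) else 0) = 0 := by
    intro τ _
    by_cases hρτ : K.Face ρ τ
    · have h1 := hc τ
      rw [PolyhedralStructure.finsum_face_eq (hρτ.1 hx)] at h1
      have h2 := congrArg (fun v => linearPart ι f ((τ : K.polyhedra) : Set X)
        (unitNormal ι (ρ : K.polyhedra) (τ : K.polyhedra)) • v) h1
      simp only [smul_zero, Finset.smul_sum] at h2
      refine Eq.trans ?_ h2
      refine Finset.sum_congr rfl fun σ _ => ?_
      by_cases hτσ : K.Face τ σ
      · have hn := isInnerNormal_unitNormal (h.cell_isFaceOfCodim hρτ)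
        have hspan := ((h.cell_isFaceOfCodim hρτ).mem_vectorSpan.1 hn.2.2.1).1
        rw [if_pos ⟨hρτ, hτσ⟩, if_pos hτσ, h.linearPart_eq hf τ.2.1 σ.2.1 hτσ.1 hspan, smul_comm]
      · simp [hτσ]
    · simp [hρτ]
  rw [Finset.sum_congr rfl step1, Finset.sum_neg_distrib, neg_eq_zero, Finset.sum_comm]
  refine Eq.trans ?_ (Finset.sum_eq_zero step2)
  rw [Finset.sum_comm (s := T)]
  refine Finset.sum_congr rfl fun σ _ => ?_
  rw [← Finset.smul_sum, ← Finset.smul_sum, h.sum_facets_eq σ hx]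

/-- The product of a positive Minkowski weight with a piecewise affine function that has linear
upper bounds, tight at any given point, near that point, is positive. -/
theorem prod_nonneg (h : IsEmbeddedStructure ι ℓ K) {f : V → ℝ} (hf : f ∈ K.PA V)
    {c : K.Weight V k} (hc : PolyhedralStructure.IsMinkowski ι c) (hpos : ∀ σ, 0 ≤ c σ)
    (hbound : ∀ (x : X) (hx : x ∈ V), ∃ p : Module.Dual ℝ N, ∀ᶠ y in 𝓝 x,
      ∀ hy : y ∈ V, f ⟨y, hy⟩ - f ⟨x, hx⟩ ≤ p (ι y - ι x)) (τ : K.cells V (k - 1)) :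
    0 ≤ PolyhedralStructure.prod ι f c τ := by
  classical
  obtain ⟨x, hx, hxV, hrel⟩ := h.exists_mem_relint_inter τ.1 τ.2.1
  obtain ⟨p, hp⟩ := hbound x hxV
  have h1 := congrArg p (hc τ)
  rw [PolyhedralStructure.finsum_face_eq hx, map_sum, map_zero] at h1
  rw [PolyhedralStructure.prod, PolyhedralStructure.finsum_face_eq hx, neg_nonneg]
  refine le_of_le_of_eq ?_ h1
  refine Finset.sum_le_sum fun σ _ => ?_
  split_ifs with hτσ
  · rw [map_smul, smul_eq_mul]
    refine mul_le_mul_of_nonneg_left ?_ (hpos σ)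
    have hxσ := hτσ.1 hx
    obtain ⟨ε, hε, hmem⟩ := (h.cell_isFaceOfCodim hτσ).exists_add_smul_mem
      (isInnerNormal_unitNormal (h.cell_isFaceOfCodim hτσ)) hrel
    have hO : {y | ∀ hy : y ∈ V, f ⟨y, hy⟩ - f ⟨x, hxV⟩ ≤ p (ι y - ι x)} ∈ 𝓝 x := hp
    obtain ⟨δ, ⟨y, hyσ, ⟨hyV, hy⟩, hyι⟩, hδ⟩ := ((h.eventually_exists_mem σ hxσ
      (Filter.inter_mem (V.isOpen.mem_nhds hxV) hO) hε hmem).and self_mem_nhdsWithin).exists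
    have hδ : 0 < δ := hδ
    have h2 := hy hyV
    rw [h.linearPart_spec hf σ.2.1 hyV hyσ, h.linearPart_spec hf σ.2.1 hxV hxσ, hyι, map_add,
      add_sub_cancel_left, add_sub_cancel_left, map_smul, map_smul, smul_eq_mul, smul_eq_mul] at h2
    exact le_of_mul_le_mul_left h2 hδ
  · rw [map_zero]

end IsEmbeddedStructure

theorem nonneg_of_isPositive {P : QuasiEmbeddedPolyhedralSpace X N}
    (a : P.MinkowskiWeight V k) (ha : a.cycle.IsPositive) : ∀ σ, 0 ≤ a.c σ := by
  obtain ⟨ℓ, -, hℓ⟩ := P.hyperplane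
  obtain ⟨b, hb, hpos⟩ := ha
  have hgen : Relation.EqvGen (P.IsPullback (U := V) (k := k)) b a := Quot.eqvGen_exact hb
  have : (∀ σ, 0 ≤ b.c σ) ↔ ∀ σ, 0 ≤ a.c σ := by
    clear hpos hb
    induction hgen with
    | rel x y hxy =>
      rw [hxy.2]
      exact ((x.isComplex.2.isEmbeddedStructure hℓ).pullback_nonneg_iff
        (y.isComplex.2.isEmbeddedStructure hℓ) hxy.1 x.c).symm
    | refl x => rfl
    | symm x y _ ih => exact ih.symm
    | trans x y z _ _ ih1 ih2 => exact ih1.trans ih2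
  exact this.1 hpos

/-- A function on `U` that has near every point a linear upper bound, tight at that point, is
concave. -/
theorem isConcave_of_forall_exists_le (P : QuasiEmbeddedPolyhedralSpace X N)
    {U : TopologicalSpace.Opens X} {f : U → ℝ}
    (hf : ∀ (x : X) (hx : x ∈ U), ∃ p : Module.Dual ℝ N, ∀ᶠ y in 𝓝 x,
      ∀ hy : y ∈ U, f ⟨y, hy⟩ - f ⟨x, hx⟩ ≤ p (P.ι y - P.ι x)) : P.IsConcave f := by
  rintro V hVU k γ hγ a rfl hPA
  obtain ⟨ℓ, -, hℓ⟩ := P.hyperplane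
  have h := a.isComplex.2.isEmbeddedStructure hℓ
  have hM := h.isMinkowski_prod hPA a.isMinkowski
  refine ⟨hM, _, rfl, h.prod_nonneg hPA a.isMinkowski (nonneg_of_isPositive a hγ) fun x hx => ?_⟩
  obtain ⟨p, hp⟩ := hf x (hVU hx)
  exact ⟨p, hp.mono fun y hy hyV => hy (hVU hyV)⟩

end Products

section Arrangements

variable {N J : Type*} [NormedAddCommGroup N] [InnerProductSpace ℝ N]

/-- The closed cell with sign vector `s` of a hyperplane arrangement. -/
def signCell (a : J → Module.Dual ℝ N) (s : J → SignType) : Set N :=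
  {n | ∀ j, a j n = 0 ∨ SignType.sign (a j n) = s j}

variable {a : J → Module.Dual ℝ N}

theorem isPolyhedron_signCell [Finite J] (s : J → SignType) : IsPolyhedron (signCell a s) := by
  have : signCell a s = ⋂ j, {n | a j n = 0 ∨ SignType.sign (a j n) = s j} := by
    ext n; simp [signCell]
  rw [this]
  refine isPolyhedron_iInter fun j => ?_
  rcases hs : s j with _ | _ | _
  · convert isPolyhedron_hyperplane (a j) 0 using 3
    simp
  · convert isPolyhedron_halfspace (a j) 0 using 3 with n
    simp only [SignType.neg_eq_neg_one, sign_eq_neg_one_iff, le_iff_eq_or_lt]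
  · convert isPolyhedron_halfspace_ge (a j) 0 using 3 with n
    simp only [SignType.pos_eq_one, sign_eq_one_iff, le_iff_eq_or_lt]
    exact or_congr_left eq_comm

theorem isExtreme_signCell_inter (s s' : J → SignType) :
    IsExtreme ℝ (signCell a s) (signCell a s ∩ signCell a s') := by
  refine ⟨Set.inter_subset_left, ?_⟩
  rintro x hx y hy _ ⟨-, hz⟩ ⟨p, q, hp, hq, -, rfl⟩
  refine ⟨hx, fun j => ?_⟩
  rcases hx j with h0 | h0
  · exact Or.inl h0
  by_cases hx0 : a j x = 0
  · exact Or.inl hx0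
  right
  have hzj := hz j
  simp only [map_add, map_smul, smul_eq_mul] at hzj
  rcases lt_or_gt_of_ne hx0 with hneg | hpos
  · have hy0 : a j y ≤ 0 := by
      rw [sign_neg hneg] at h0
      rcases hy j with h | h
      · exact h.le
      · rw [← h0, sign_eq_neg_one_iff] at h; exact h.le
    have : p * a j x + q * a j y < 0 := by
      have := mul_neg_of_pos_of_neg hp hneg
      have := mul_nonpos_of_nonneg_of_nonpos hq.le hy0
      linarith
    rw [sign_neg this] at hzj
    rw [sign_neg hneg]
    exact hzj.resolve_left this.ne
  · have hy0 : 0 ≤ a j y := by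
      rw [sign_pos hpos] at h0
      rcases hy j with h | h
      · exact h.ge
      · rw [← h0, sign_eq_one_iff] at h; exact h.le
    have : 0 < p * a j x + q * a j y := by positivity
    rw [sign_pos this] at hzj
    rw [sign_pos hpos]
    exact hzj.resolve_left this.ne'

theorem mem_signCell_sign (x : N) : x ∈ signCell a fun j => SignType.sign (a j x) :=
  fun _ => Or.inr rfl

theorem mem_relint_signCell [Finite J] (x : N) :
    x ∈ relint (signCell a fun j => SignType.sign (a j x)) := by
  refine ⟨mem_signCell_sign x, fun y hy => ?_⟩
  have key : ∀ j, ∀ᶠ ε in 𝓝[>] (0 : ℝ), a j (x + ε • (x - y)) = 0 ∨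
      SignType.sign (a j (x + ε • (x - y))) = SignType.sign (a j x) := by
    intro j
    have ht : Filter.Tendsto (fun ε : ℝ => a j (x + ε • (x - y))) (𝓝[>] 0) (𝓝 (a j x)) := by
      have : Filter.Tendsto (fun ε : ℝ => a j x + ε * (a j x - a j y)) (𝓝[>] 0)
            (𝓝 (a j x + 0 * (a j x - a j y))) := by
          refine Filter.Tendsto.mono_left ?_ nhdsWithin_le_nhds
          exact Continuous.tendsto (by fun_prop) 0
      rw [zero_mul, add_zero] at this
      simpa using this
    rcases lt_trichotomy (a j x) 0 with h | h | h
    · filter_upwards [ht.eventually_lt_const h] with ε hε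
      rw [sign_neg h, sign_neg hε]; exact Or.inr rfl
    · refine Filter.Eventually.of_forall fun ε => Or.inl ?_
      have : a j y = 0 := by
        rcases hy j with h' | h'
        · exact h'
        · simp only [h, sign_zero] at h'; exact sign_eq_zero_iff.1 h'
      simp [h, this]
    · filter_upwards [ht.eventually_const_lt h] with ε hε
      rw [sign_pos h, sign_pos hε]; exact Or.inr rfl
  obtain ⟨ε, h1, h2⟩ := ((Filter.eventually_all.2 key).and self_mem_nhdsWithin).exists
  exact ⟨ε, h2, h1⟩

theorem signCell_sign_subset {s : J → SignType} {x : N} (hx : x ∈ signCell a s) :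
    signCell a (fun j => SignType.sign (a j x)) ⊆ signCell a s := by
  intro n hn j
  rcases hn j with h | h
  · exact Or.inl h
  rcases hx j with h' | h'
  · simp only [h', sign_zero] at h; exact Or.inl (sign_eq_zero_iff.1 h)
  · exact Or.inr (h.trans h')

theorem subset_signCell_sign {s : J → SignType} {F : Set N} (hF : F ⊆ signCell a s) {x : N}
    (hx : x ∈ relint F) : F ⊆ signCell a (fun j => SignType.sign (a j x)) := by
  intro y hy j
  obtain ⟨ε, hε, h⟩ := hx.2 y hy
  by_cases hyj : a j y = 0
  · exact Or.inl hyj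
  right
  have h1 := (hF hy j).resolve_left hyj
  rcases hF hx.1 j with h0 | h0
  · exfalso
    have h2 := hF h j
    have h3 : a j (x + ε • (x - y)) = -(ε * a j y) := by simp [h0]
    rw [h3, ← h1] at h2
    have h4 := h2.resolve_left (neg_ne_zero.2 (mul_ne_zero hε.ne' hyj))
    rcases lt_or_gt_of_ne hyj with hlt | hgt
    · have : 0 < -(ε * a j y) := by
        have := mul_neg_of_pos_of_neg hε hlt
        linarith
      rw [sign_neg hlt, sign_pos this] at h4
      exact absurd h4 (by decide)
    · have : -(ε * a j y) < 0 := by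
        have := mul_pos hε hgt
        linarith
      rw [sign_pos hgt, sign_neg this] at h4
      exact absurd h4 (by decide)
  · exact h1.trans h0.symm

theorem relint_inter {E : Type*} [AddCommGroup E] [Module ℝ E] {A B : Set E} (hA : Convex ℝ A)
    (hB : Convex ℝ B) {x : E} (hxA : x ∈ relint A) (hxB : x ∈ relint B) : x ∈ relint (A ∩ B) := by
  refine ⟨⟨hxA.1, hxB.1⟩, fun y hy => ?_⟩
  obtain ⟨ε, hε, h⟩ := hxA.2 y hy.1
  obtain ⟨δ, hδ, h'⟩ := hxB.2 y hy.2
  exact ⟨min ε δ, lt_min hε hδ,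
    add_smul_mem_of_le hA hxA.1 h (lt_min hε hδ).le (min_le_left _ _),
    add_smul_mem_of_le hB hxB.1 h' (lt_min hε hδ).le (min_le_right _ _)⟩

theorem IsPolyhedron.isClosed [FiniteDimensional ℝ N] {P : Set N} (h : IsPolyhedron P) :
    IsClosed P := by
  obtain ⟨s, rfl⟩ := h
  simp only [Set.ofPred_forall]
  exact isClosed_biInter fun p _ =>
    isClosed_le p.1.continuous_of_finiteDimensional continuous_const

end Arrangements

section Refinement

set_option linter.unusedSectionVars false

variable {X N J : Type*} [TopologicalSpace X] [NormedAddCommGroup N] [InnerProductSpace ℝ N]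
  [FiniteDimensional ℝ N] {ι : X → N} {ℓ : Module.Dual ℝ N} {K K' : PolyhedralStructure X}

theorem isAffineOn_inclusion {s t : Set X} (hst : s ⊆ t) {M : Submodule ℝ C(s, ℝ)}
    {M' : Submodule ℝ C(t, ℝ)} (hM : M = linFun ι s) (hM' : M' = linFun ι t)
    (hs : Continuous fun x : s => ι x) (ht : Continuous fun x : t => ι x) :
    IsAffineOn M fun x => evalMap M' (Set.inclusion hst x) := by
  subst hM hM'
  obtain ⟨g, hg⟩ := (dualToSpace ht).exists_leftInverse_of_injective
    (LinearMap.ker_eq_bot.mpr (dualToSpace_injective ht))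
  refine ⟨(g ∘ₗ dualToSpace hs).toAffineMap, fun x => ?_⟩
  have h1 : g (dualToSpace ht (evalMap (linFun ι t) (Set.inclusion hst x))) = _ :=
    LinearMap.congr_fun hg _
  rw [dualToSpace_evalMap] at h1
  simp only [LinearMap.coe_toAffineMap, LinearMap.comp_apply, dualToSpace_evalMap]
  exact h1.symm

namespace IsEmbeddedStructure

theorem isSubdivision (h : IsEmbeddedStructure ι ℓ K) (h' : IsEmbeddedStructure ι ℓ K')
    (hsub : ∀ σ' : K'.polyhedra, ∃ σ : K.polyhedra, (σ' : Set X) ⊆ σ) : K'.IsSubdivision K := by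
  intro σ'
  obtain ⟨σ, hσ⟩ := hsub σ'
  exact ⟨σ, hσ, isAffineOn_inclusion hσ (h'.aff_eq σ') (h.aff_eq σ)
    (h'.isEmbedding σ').continuous (h.isEmbedding σ).continuous⟩

theorem isEmbedding_of_subset (h : IsEmbeddedStructure ι ℓ K) (σ : K.polyhedra) {s : Set X}
    (hs : s ⊆ σ) : Topology.IsEmbedding fun x : s => ι x :=
  (h.isEmbedding σ).comp (Topology.IsEmbedding.inclusion hs)

theorem empty_mem (h : IsEmbeddedStructure ι ℓ K) (σ : K.polyhedra) : ∅ ∈ K.polyhedra := by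
  refine (K.face_mem σ ∅ ((h.isFaceOf_iff σ ∅).2 ⟨Set.empty_subset _, ?_⟩)).1
  rw [Set.image_empty]
  exact ⟨convex_empty, Set.empty_subset _, fun _ _ _ _ _ hz => hz.elim⟩

variable [Finite J] (a : J → Module.Dual ℝ N)

/-- A face of a cell `σ ∩ ι⁻¹(Q)` is again such a cell. -/
theorem exists_eq_of_isFaceOf (h : IsEmbeddedStructure ι ℓ K) (σ : K.polyhedra)
    (s : J → SignType) {τ : Set X} (hτ : τ ⊆ (σ : Set X) ∩ ι ⁻¹' signCell a s)
    (hface : IsConvexFace (ι '' ((σ : Set X) ∩ ι ⁻¹' signCell a s)) (ι '' τ)) :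
    ∃ (σ₁ : K.polyhedra) (s₁ : J → SignType), τ = (σ₁ : Set X) ∩ ι ⁻¹' signCell a s₁ := by
  rcases τ.eq_empty_or_nonempty with rfl | hne
  · exact ⟨⟨∅, h.empty_mem σ⟩, s, by simp⟩
  obtain ⟨_, hrel⟩ := relint_nonempty hface.1 (hne.image ι)
  obtain ⟨x, hx, rfl⟩ := hrel.1
  obtain ⟨σ₁, hσ₁, hxσ₁, hrel₁⟩ := h.exists_face_mem_relint σ (hτ hx).1
  have hτσ : ι '' τ ⊆ ι '' (σ : Set X) := Set.image_mono fun y hy => (hτ hy).1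
  refine ⟨σ₁, fun j => SignType.sign (a j (ι x)), Set.Subset.antisymm (fun y hy => ⟨?_, ?_⟩) ?_⟩
  · obtain ⟨z, hz, hzy⟩ := PolyhedralSpaces.subset_of_mem_relint
      ((h.isFaceOf_iff σ _).1 hσ₁).2.2 hτσ hrel ⟨x, hxσ₁, rfl⟩ (Set.mem_image_of_mem ι hy)
    exact (h.injOn σ (hσ₁.1 hz) (hτ hy).1 hzy) ▸ hz
  · exact subset_signCell_sign (s := s) (by rintro _ ⟨z, hz, rfl⟩; exact (hτ hz).2) hrel
      (Set.mem_image_of_mem ι hy)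
  · have hG : ι '' ((σ₁ : Set X) ∩ ι ⁻¹' signCell a fun j => SignType.sign (a j (ι x))) ⊆
        ι '' ((σ : Set X) ∩ ι ⁻¹' signCell a s) :=
      Set.image_mono (Set.inter_subset_inter hσ₁.1
        (Set.preimage_mono (signCell_sign_subset (hτ hx).2)))
    have hrel₂ : ι x ∈ relint
        (ι '' ((σ₁ : Set X) ∩ ι ⁻¹' signCell a fun j => SignType.sign (a j (ι x)))) := by
      rw [Set.image_inter_preimage]
      exact relint_inter (h.convex σ₁) (isPolyhedron_signCell _).convex hrel₁
        (mem_relint_signCell (ι x))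
    rintro y ⟨hy, hy'⟩
    obtain ⟨z, hz, hzy⟩ := PolyhedralSpaces.subset_of_mem_relint hface.2 hG hrel₂
      (Set.mem_image_of_mem ι hx) ⟨y, ⟨hy, hy'⟩, rfl⟩
    exact (h.injOn σ (hτ hz).1 (hσ₁.1 hy) hzy) ▸ hz

theorem isFaceOf_inter_cell (h : IsEmbeddedStructure ι ℓ K) (σ σ' : K.polyhedra)
    (s s' : J → SignType) :
    IsFaceOf (linFun ι ((σ : Set X) ∩ ι ⁻¹' signCell a s))
      (((σ : Set X) ∩ ι ⁻¹' signCell a s) ∩ ((σ' : Set X) ∩ ι ⁻¹' signCell a s')) := by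
  rw [isFaceOf_linFun_iff (h.isEmbedding_of_subset σ Set.inter_subset_left).continuous]
  refine ⟨Set.inter_subset_left, ?_⟩
  rw [Set.inter_inter_inter_comm, ← Set.preimage_inter, Set.image_inter_preimage,
    Set.image_inter_preimage]
  have h1 := h.isConvexFace_inter σ σ'
  refine ⟨h1.1.inter ((isPolyhedron_signCell s).inter (isPolyhedron_signCell s')).convex,
    Set.inter_subset_inter h1.2.1 Set.inter_subset_left, ?_⟩
  rintro x ⟨hx, hx'⟩ y ⟨hy, hy'⟩ z ⟨hz, hz'⟩ hxyz
  exact ⟨h1.2.2 hx hy hz hxyz, (isExtreme_signCell_inter s s').2 hx' hy' hz' hxyz⟩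

/-- The subdivision of a polyhedral structure by the pullback of a hyperplane arrangement. -/
def refinement (h : IsEmbeddedStructure ι ℓ K) : PolyhedralStructure X where
  polyhedra := {c | ∃ (σ : K.polyhedra) (s : J → SignType), c = (σ : Set X) ∩ ι ⁻¹' signCell a s}
  aff c := linFun ι c
  isClosed := by
    rintro _ ⟨σ, s, rfl⟩
    exact (continuousOn_iff_continuous_domRestrict.2
      (h.isEmbedding σ).continuous).preimage_isClosed_of_isClosed (K.isClosed σ σ.2)
      (isPolyhedron_signCell s).isClosed
  cover := by
    rw [Set.eq_univ_iff_forall]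
    intro x
    obtain ⟨σ, hσ⟩ := exists_mem K x
    exact ⟨_, ⟨σ, fun j => SignType.sign (a j (ι x)), rfl⟩, hσ, mem_signCell_sign (ι x)⟩
  locallyFinite := by
    intro x
    obtain ⟨t, ht, hfin⟩ := K.locallyFinite x
    refine ⟨t, ht, ((hfin.prod (Set.finite_univ (α := J → SignType))).image
      fun p => ⟨(p.1 : Set X) ∩ ι ⁻¹' signCell a p.2, p.1, p.2, rfl⟩).subset ?_⟩
    rintro ⟨_, σ, s, rfl⟩ hc
    exact ⟨(σ, s), ⟨hc.mono (Set.inter_subset_inter_left _ Set.inter_subset_left), trivial⟩, rfl⟩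
  chart := by
    rintro ⟨_, σ, s, rfl⟩
    refine isPolyhedralChart_linFun (fun x _ => h.eq_one x)
      (h.isEmbedding_of_subset σ Set.inter_subset_left) ?_
    change IsPolyhedron (ι '' ((σ : Set X) ∩ ι ⁻¹' signCell a s))
    rw [Set.image_inter_preimage]
    exact (h.isPolyhedron σ).inter (isPolyhedron_signCell s)
  face_mem := by
    rintro ⟨_, σ, s, rfl⟩ τ hτ
    have hc := (h.isEmbedding_of_subset σ
      (Set.inter_subset_left (s := (σ : Set X)) (t := ι ⁻¹' signCell a s))).continuous
    have hτ' := (isFaceOf_linFun_iff hc).1 hτ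
    refine ⟨h.exists_eq_of_isFaceOf a σ s hτ'.1 hτ'.2, fun g => ⟨?_, ?_⟩⟩
    · rintro ⟨p, hp⟩
      exact ⟨linPullback hc p, (linPullback hc p).2, fun x hx _ => hp ⟨x, hx⟩⟩
    · rintro ⟨m, ⟨p, hp⟩, hm⟩
      exact ⟨p, fun x => (hm x x.2 (hτ'.1 x.2)).trans (hp ⟨x, hτ'.1 x.2⟩)⟩
  inter_face := by
    rintro ⟨_, σ, s, rfl⟩ ⟨_, σ', s', rfl⟩
    refine ⟨h.isFaceOf_inter_cell a σ σ' s s', ?_⟩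
    have := h.isFaceOf_inter_cell a σ' σ s' s
    rwa [Set.inter_comm ((σ' : Set X) ∩ _)] at this

theorem refinement_isEmbeddedStructure (h : IsEmbeddedStructure ι ℓ K) :
    IsEmbeddedStructure ι ℓ (h.refinement a) where
  eq_one := h.eq_one
  aff_eq _ := rfl
  isEmbedding := by
    rintro ⟨_, σ, s, rfl⟩
    exact h.isEmbedding_of_subset σ Set.inter_subset_left
  isPolyhedron := by
    rintro ⟨_, σ, s, rfl⟩
    change IsPolyhedron (ι '' ((σ : Set X) ∩ ι ⁻¹' signCell a s))
    rw [Set.image_inter_preimage]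
    exact (h.isPolyhedron σ).inter (isPolyhedron_signCell s)

theorem refinement_isSubdivision (h : IsEmbeddedStructure ι ℓ K) :
    (h.refinement a).IsSubdivision K := by
  refine h.isSubdivision (h.refinement_isEmbeddedStructure a) ?_
  rintro ⟨_, σ, s, rfl⟩
  exact ⟨σ, Set.inter_subset_left⟩

theorem refinement_mono (h : IsEmbeddedStructure ι ℓ K) (h' : IsEmbeddedStructure ι ℓ K')
    (hsub : K'.IsSubdivision K) : (h'.refinement a).IsSubdivision (h.refinement a) := by
  refine (h.refinement_isEmbeddedStructure a).isSubdivision (h'.refinement_isEmbeddedStructure a) ?_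
  rintro ⟨_, σ', s, rfl⟩
  obtain ⟨σ, hσ, -⟩ := hsub σ'
  exact ⟨⟨_, σ, s, rfl⟩, Set.inter_subset_inter_left _ hσ⟩

end IsEmbeddedStructure

theorem IsAdapted.of_isSubdivision (hK : IsAdapted ι K) (hsub : K'.IsSubdivision K) :
    IsAdapted ι K' := by
  intro σ'
  obtain ⟨σ, hσ, L, hL⟩ := hsub σ'
  obtain ⟨⟨L', hL'⟩, hinj⟩ := hK σ
  exact ⟨⟨L'.comp L, fun x => by
    rw [AffineMap.comp_apply, ← hL x]; exact hL' (Set.inclusion hσ x)⟩, hinj.mono hσ⟩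

theorem PolyhedralStructure.IsSubdivision.trans {K'' : PolyhedralStructure X}
    (h' : K''.IsSubdivision K') (h : K'.IsSubdivision K) : K''.IsSubdivision K := by
  intro σ''
  obtain ⟨σ', hσ', L', hL'⟩ := h' σ''
  obtain ⟨σ, hσ, L, hL⟩ := h σ'
  exact ⟨σ, hσ'.trans hσ, L.comp L', fun x => by
    rw [AffineMap.comp_apply, ← hL' x]; exact hL (Set.inclusion hσ' x)⟩

theorem isComplex_refinement [Finite J] (a : J → Module.Dual ℝ N)
    (P : QuasiEmbeddedPolyhedralSpace X N) (hK : P.IsComplex K)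
    (h : IsEmbeddedStructure P.ι ℓ K) : P.IsComplex (h.refinement a) := by
  refine ⟨?_, (h.refinement_isEmbeddedStructure a).isAdapted⟩
  obtain ⟨K₀, hK₀⟩ := P.isClass
  have h1 := hK.1
  rw [hK₀] at h1 ⊢
  obtain ⟨K₁, h10, h11⟩ := h1
  have h₁ := (hK.2.of_isSubdivision h11).isEmbeddedStructure h.eq_one
  exact ⟨h₁.refinement a, (h₁.refinement_isSubdivision a).trans h10, h.refinement_mono a h₁ h11⟩

end Refinement

section Bounds

theorem exists_le_mul_sum_abs {E J : Type*} [AddCommGroup E] [Module ℝ E] (ℓ q : Module.Dual ℝ E)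
    (a : J → Module.Dual ℝ E) (B : Finset J)
    (hq : ∀ v, ℓ v = 0 → (∀ j ∈ B, a j v = 0) → q v = 0) :
    ∃ C : ℝ, ∀ v, ℓ v = 0 → q v ≤ C * ∑ j ∈ B, |a j v| := by
  let L : Option B → Module.Dual ℝ E := fun o => o.elim ℓ fun j => a j
  have hmem : q ∈ Submodule.span ℝ (Set.range L) := by
    refine mem_span_of_iInf_ker_le_ker fun v hv => ?_
    rw [Submodule.mem_iInf] at hv
    exact hq v (hv none) fun j hj => hv (some ⟨j, hj⟩)
  obtain ⟨c, rfl⟩ := (Submodule.mem_span_range_iff_exists_fun ℝ).1 hmem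
  refine ⟨∑ j : B, |c (some j)|, fun v hv => ?_⟩
  have expand : (∑ i, c i • L i) v = ∑ j : B, c (some j) * a j v := by
    simp [Fintype.sum_option, L, hv]
  rw [expand, Finset.sum_mul]
  refine Finset.sum_le_sum fun j _ => ?_
  calc c (some j) * a j v ≤ |c (some j)| * |a j v| := by
        rw [← abs_mul]; exact le_abs_self _
    _ ≤ _ := mul_le_mul_of_nonneg_left
        (Finset.single_le_sum (f := fun j => |a j v|) (fun j _ => abs_nonneg _) j.2)
        (abs_nonneg _)

theorem exists_homogeneous_inequalities {E : Type*} [AddCommGroup E] [Module ℝ E] {P : Set E}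
    (hP : IsPolyhedron P) {ℓ : Module.Dual ℝ E} (hℓ : ∀ x ∈ P, ℓ x = 1) :
    ∃ T : Finset (Module.Dual ℝ E), ∀ n, n ∈ P ↔ ℓ n = 1 ∧ ∀ p ∈ T, p n ≤ 0 := by
  classical
  obtain ⟨S, hS⟩ := hP
  refine ⟨S.image fun p => p.1 - p.2 • ℓ, fun n => ?_⟩
  have key : ℓ n = 1 → ((∀ p ∈ S, p.1 n ≤ p.2) ↔
      ∀ p ∈ S.image fun p : Module.Dual ℝ E × ℝ => p.1 - p.2 • ℓ, p n ≤ 0) := by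
    intro hn
    rw [Finset.forall_mem_image]
    refine forall₂_congr fun p _ => ?_
    rw [LinearMap.sub_apply, LinearMap.smul_apply, hn, smul_eq_mul, mul_one, sub_nonpos]
  have hmem : n ∈ P ↔ ∀ p ∈ S, p.1 n ≤ p.2 := by rw [hS]; rfl
  exact ⟨fun h => ⟨hℓ n h, (key (hℓ n h)).1 (hmem.1 h)⟩, fun h => hmem.2 ((key h.1).2 h.2)⟩

theorem eventually_sign_eq {E : Type*} [AddCommGroup E] [Module ℝ E] (p : Module.Dual ℝ E) (x v : E)
    (h : p x = 0 → p v = 0) :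
    ∀ᶠ ε in 𝓝[>] (0 : ℝ), SignType.sign (p (x + ε • v)) = SignType.sign (p x) := by
  have ht : Filter.Tendsto (fun ε : ℝ => p (x + ε • v)) (𝓝[>] 0) (𝓝 (p x)) := by
    have : Filter.Tendsto (fun ε : ℝ => p x + ε * p v) (𝓝[>] 0) (𝓝 (p x + 0 * p v)) :=
      Filter.Tendsto.mono_left (Continuous.tendsto (by fun_prop) 0) nhdsWithin_le_nhds
    rw [zero_mul, add_zero] at this
    simpa using this
  rcases lt_trichotomy (p x) 0 with hx | hx | hx
  · filter_upwards [ht.eventually_lt_const hx] with ε hε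
    rw [sign_neg hx, sign_neg hε]
  · refine Filter.Eventually.of_forall fun ε => ?_
    simp [hx, h hx]
  · filter_upwards [ht.eventually_const_lt hx] with ε hε
    rw [sign_pos hx, sign_pos hε]

end Bounds

section Difference

set_option linter.unusedSectionVars false

variable {X N J : Type*} [TopologicalSpace X] [NormedAddCommGroup N] [InnerProductSpace ℝ N]
  [FiniteDimensional ℝ N] {ι : X → N} {ℓ : Module.Dual ℝ N} {K : PolyhedralStructure X}
  {U : TopologicalSpace.Opens X} [Fintype J] {a : J → Module.Dual ℝ N}

namespace IsEmbeddedStructure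

theorem add_mem_PA (h : IsEmbeddedStructure ι ℓ K) {f g : U → ℝ} (hf : f ∈ K.PA U)
    (hg : g ∈ K.PA U) : f + g ∈ K.PA U := by
  rw [h.mem_PA_iff] at *
  intro σ hσ
  obtain ⟨p, hp⟩ := hf σ hσ
  obtain ⟨q, hq⟩ := hg σ hσ
  exact ⟨p + q, fun x hx hxσ => by
    rw [Pi.add_apply, hp x hx hxσ, hq x hx hxσ, LinearMap.add_apply]⟩

theorem smul_mem_PA (h : IsEmbeddedStructure ι ℓ K) {f : U → ℝ} (hf : f ∈ K.PA U) (c : ℝ) :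
    c • f ∈ K.PA U := by
  rw [h.mem_PA_iff] at *
  intro σ hσ
  obtain ⟨p, hp⟩ := hf σ hσ
  exact ⟨c • p, fun x hx hxσ => by rw [Pi.smul_apply, hp x hx hxσ, LinearMap.smul_apply]⟩

theorem zero_mem_PA (h : IsEmbeddedStructure ι ℓ K) : (0 : U → ℝ) ∈ K.PA U :=
  h.mem_PA_iff.2 fun _ _ => ⟨0, fun _ _ _ => rfl⟩

/-- The arrangement `a` cuts out all polyhedra of `K` that meet `U`. -/
def IsCutOut (ι : X → N) (ℓ : Module.Dual ℝ N) (K : PolyhedralStructure X)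
    (U : TopologicalSpace.Opens X) (a : J → Module.Dual ℝ N) : Prop :=
  ∀ σ ∈ K.restriction U, ∃ T : Set J, ∀ n, n ∈ ι '' (σ : Set X) ↔ ℓ n = 1 ∧ ∀ j ∈ T, a j n ≤ 0

/-- The negative sum of the absolute values of the functions of an arrangement. -/
def arrangementFun (ι : X → N) (U : TopologicalSpace.Opens X) (a : J → Module.Dual ℝ N) : U → ℝ :=
  fun x => -∑ j, |a j (ι x)|

theorem arrangementFun_mem_PA (h : IsEmbeddedStructure ι ℓ K) :
    arrangementFun ι U a ∈ (h.refinement a).PA U := by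
  rw [(h.refinement_isEmbeddedStructure a).mem_PA_iff]
  rintro ⟨_, σ, s, rfl⟩ -
  refine ⟨-∑ j, (s j : ℝ) • a j, fun x hx hxσ => ?_⟩
  simp only [arrangementFun, LinearMap.neg_apply, LinearMap.sum_apply, LinearMap.smul_apply,
    smul_eq_mul, neg_inj]
  refine Finset.sum_congr rfl fun j _ => ?_
  rcases hxσ.2 j with h0 | h0
  · simp [h0]
  · rw [← h0, sign_mul_self]

theorem exists_add_smul_mem_cell (h : IsEmbeddedStructure ι ℓ K) (hcut : IsCutOut ι ℓ K U a)
    {c : (h.refinement a).polyhedra} (hc : c ∈ (h.refinement a).restriction U) {x : X}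
    (hx : x ∈ (c : Set X)) {v : N} (hv : ℓ v = 0) (hav : ∀ j, a j (ι x) = 0 → a j v = 0) :
    ∃ ε : ℝ, 0 < ε ∧ ι x + ε • v ∈ ι '' (c : Set X) := by
  obtain ⟨_, σ, s, rfl⟩ := c
  obtain ⟨T, hT⟩ := hcut σ (hc.mono (Set.inter_subset_inter_left _ Set.inter_subset_left))
  obtain ⟨ε, hsign, hε⟩ := ((Filter.eventually_all.2 fun j =>
    eventually_sign_eq (a j) (ι x) v (hav j)).and self_mem_nhdsWithin).exists
  refine ⟨ε, hε, ?_⟩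
  change _ ∈ ι '' ((σ : Set X) ∩ ι ⁻¹' signCell a s)
  rw [Set.image_inter_preimage]
  refine ⟨(hT _).2 ⟨by rw [map_add, map_smul, hv, h.eq_one, smul_zero, add_zero], fun j hj => ?_⟩,
    fun j => ?_⟩
  · have h1 := ((hT _).1 (Set.mem_image_of_mem ι hx.1)).2 j hj
    rwa [← sign_nonpos_iff, ← hsign j, sign_nonpos_iff] at h1
  · have h2 := hx.2 j
    rwa [← sign_eq_zero_iff, ← hsign j, sign_eq_zero_iff] at h2

theorem linear_eq_of_mem_cells (h : IsEmbeddedStructure ι ℓ K) (hcut : IsCutOut ι ℓ K U a)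
    {g : U → ℝ} {c c' : (h.refinement a).polyhedra} (hc : c ∈ (h.refinement a).restriction U)
    {p p' : Module.Dual ℝ N}
    (hp : ∀ (x : X) (hx : x ∈ U), x ∈ (c : Set X) → g ⟨x, hx⟩ = p (ι x))
    (hp' : ∀ (x : X) (hx : x ∈ U), x ∈ (c' : Set X) → g ⟨x, hx⟩ = p' (ι x))
    {x : X} (hxU : x ∈ U) (hx : x ∈ (c : Set X)) (hx' : x ∈ (c' : Set X)) {v : N} (hv : ℓ v = 0)
    (hav : ∀ j, a j (ι x) = 0 → a j v = 0) : p v = p' v := by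
  have hr := h.refinement_isEmbeddedStructure a
  obtain ⟨ε₀, hε₀, h₀⟩ := h.exists_add_smul_mem_cell hcut hc hx hv hav
  obtain ⟨δ, hδ, hδc⟩ := h.exists_add_smul_mem_cell hcut hc hx (v := -v) (by simp [hv])
    fun j hj => by simp [hav j hj]
  obtain ⟨ε, ⟨z, hzc, hzU, hz⟩, hε⟩ :=
    ((hr.eventually_exists_mem c hx (U.isOpen.mem_nhds hxU) hε₀ h₀).and self_mem_nhdsWithin).exists
  have hε : 0 < ε := hε
  have hzc' : z ∈ (c' : Set X) := by
    have hface := hr.isConvexFace_inter c c'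
    have hseg : ι x ∈ openSegment ℝ (ι z) (ι x + δ • -v) := by
      have h1 : ι x + δ • -v = ι x + (δ / ε) • (ι x - ι z) := by
        rw [hz, sub_add_cancel_left, smul_neg, smul_neg, smul_smul, div_mul_cancel₀ _ hε.ne']
      rw [h1]
      exact mem_openSegment_prolong _ _ (by positivity)
    obtain ⟨w, hw, hwz⟩ := hface.2.2 (Set.mem_image_of_mem ι hzc) hδc ⟨x, ⟨hx, hx'⟩, rfl⟩ hseg
    exact (hr.injOn c hw.1 hzc hwz) ▸ hw.2
  have e1 := (hp z hzU hzc).symm.trans (hp' z hzU hzc')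
  have e2 := (hp x hxU hx).symm.trans (hp' x hxU hx')
  rw [hz, map_add, map_add, e2, add_right_inj, map_smul, map_smul, smul_eq_mul, smul_eq_mul] at e1
  exact mul_left_cancel₀ hε.ne' e1

theorem finite_refinement_restriction (h : IsEmbeddedStructure ι ℓ K)
    (hfin : (K.restriction U).Finite) : ((h.refinement a).restriction U).Finite := by
  refine ((hfin.prod (Set.finite_univ (α := J → SignType))).image
      fun p => (⟨(p.1 : Set X) ∩ ι ⁻¹' signCell a p.2, p.1, p.2, rfl⟩ :
        (h.refinement a).polyhedra)).subset ?_
  rintro ⟨_, σ, s, rfl⟩ hc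
  exact ⟨(σ, s), ⟨hc.mono (Set.inter_subset_inter_left _ Set.inter_subset_left), trivial⟩, rfl⟩

/-- Adding a large multiple of `arrangementFun` makes every piecewise affine function concave. -/
theorem exists_forall_le (h : IsEmbeddedStructure ι ℓ K) (hcut : IsCutOut ι ℓ K U a)
    (hfin : (K.restriction U).Finite) {g : U → ℝ} (hg : g ∈ (h.refinement a).PA U) :
    ∃ C₀ : ℝ, ∀ C ≥ C₀, 0 ≤ C → ∀ (x : X) (hx : x ∈ U), ∃ p : Module.Dual ℝ N, ∀ᶠ y in 𝓝 x,
      ∀ hy : y ∈ U, (g + C • arrangementFun ι U a) ⟨y, hy⟩ -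
        (g + C • arrangementFun ι U a) ⟨x, hx⟩ ≤ p (ι y - ι x) := by
  classical
  have hr := h.refinement_isEmbeddedStructure a
  set K' := h.refinement a with hK'
  have := (h.finite_refinement_restriction (a := a) hfin).to_subtype
  choose p hp using hr.mem_PA_iff.1 hg
  have hC : ∀ i : K'.restriction U × K'.restriction U × Finset J, ∃ C : ℝ, ∀ x ∈ U,
      x ∈ ((i.1 : K'.polyhedra) : Set X) → x ∈ ((i.2.1 : K'.polyhedra) : Set X) →
      (Finset.univ.filter fun j => a j (ι x) = 0) = i.2.2 → ∀ v, ℓ v = 0 →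
      (p i.1 i.1.2 - p i.2.1 i.2.1.2) v ≤ C * ∑ j ∈ i.2.2, |a j v| := by
    rintro ⟨c, c', B⟩
    by_cases hex : ∃ x ∈ U, x ∈ ((c : K'.polyhedra) : Set X) ∧ x ∈ ((c' : K'.polyhedra) : Set X) ∧
        (Finset.univ.filter fun j => a j (ι x) = 0) = B
    · obtain ⟨x, hxU, hxc, hxc', rfl⟩ := hex
      obtain ⟨C, hC⟩ := exists_le_mul_sum_abs ℓ (p c c.2 - p c' c'.2) a
        (Finset.univ.filter fun j => a j (ι x) = 0) fun v hv hav => by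
          rw [LinearMap.sub_apply, sub_eq_zero]
          exact h.linear_eq_of_mem_cells hcut c.2 (hp c c.2) (hp c' c'.2) hxU hxc hxc' hv
            fun j hj => hav j (by simpa using hj)
      exact ⟨C, fun _ _ _ _ _ => hC⟩
    · exact ⟨0, fun x h1 h2 h3 h4 => (hex ⟨x, h1, h2, h3, h4⟩).elim⟩
  choose C' hC' using hC
  obtain ⟨C₀, hC₀⟩ := Finite.exists_le C'
  refine ⟨C₀, fun C hC hCpos x hx => ?_⟩
  obtain ⟨c₀, hc₀⟩ := exists_mem K' x
  have hc₀U : c₀ ∈ K'.restriction U := ⟨x, hc₀, hx⟩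
  refine ⟨p c₀ hc₀U - C • ∑ j, (SignType.sign (a j (ι x)) : ℝ) • a j, ?_⟩
  filter_upwards [eventually_mem_of_mem K' x] with y hy hyU
  obtain ⟨c, hc⟩ := exists_mem K' y
  have hcU : c ∈ K'.restriction U := ⟨y, hc, hyU⟩
  set v := ι y - ι x with hv
  have hℓv : ℓ v = 0 := by rw [hv, map_sub, h.eq_one, h.eq_one, sub_self]
  have h1 := hC' (⟨c, hcU⟩, ⟨c₀, hc₀U⟩, Finset.univ.filter fun j => a j (ι x) = 0) x hx
    (hy c hc) hc₀ rfl v hℓv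
  have h2 : (p c hcU - p c₀ hc₀U) v ≤
      C * ∑ j ∈ Finset.univ.filter fun j => a j (ι x) = 0, |a j v| :=
    h1.trans (mul_le_mul_of_nonneg_right ((hC₀ _).trans hC)
      (Finset.sum_nonneg fun j _ => abs_nonneg _))
  have h3 : ∑ j ∈ Finset.univ.filter (fun j => a j (ι x) = 0), |a j v| +
      ∑ j, (|a j (ι x)| - |a j (ι y)|) ≤
      -∑ j, (SignType.sign (a j (ι x)) : ℝ) * a j v := by
    rw [Finset.sum_filter, ← Finset.sum_add_distrib, ← Finset.sum_neg_distrib]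
    refine Finset.sum_le_sum fun j _ => ?_
    split_ifs with hj
    · simp [hv, hj]
    · have h4 := sign_mul_self (a j (ι x))
      have h5 : (SignType.sign (a j (ι x)) : ℝ) * a j (ι y) ≤ |a j (ι y)| := by
        rcases lt_or_gt_of_ne hj with hlt | hgt
        · rw [sign_neg hlt]; simpa using neg_le_abs (a j (ι y))
        · rw [sign_pos hgt]; simpa using le_abs_self (a j (ι y))
      rw [hv, map_sub, mul_sub, h4]
      linarith
  have h6 := mul_le_mul_of_nonneg_left h3 hCpos
  simp only [Pi.add_apply, Pi.smul_apply, smul_eq_mul, arrangementFun, LinearMap.sub_apply,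
    LinearMap.smul_apply, LinearMap.sum_apply] at h2 ⊢
  rw [hp c hcU y hyU hc, hp c hcU x hx (hy c hc)]
  rw [mul_add, Finset.sum_sub_distrib, mul_sub] at h6
  have h7 : p c hcU v = p c hcU (ι y) - p c hcU (ι x) := by rw [hv, map_sub]
  linarith

theorem exists_isCutOut (h : IsEmbeddedStructure ι ℓ K) (hfin : (K.restriction U).Finite) :
    ∃ A : Finset (Module.Dual ℝ N), IsCutOut ι ℓ K U (fun p : A => (p : Module.Dual ℝ N)) := by
  classical
  choose T hT using fun σ => exists_homogeneous_inequalities (h.isPolyhedron σ) (h.image_eq_one σ)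
  refine ⟨hfin.toFinset.biUnion T, fun σ hσ => ⟨{p | (p : Module.Dual ℝ N) ∈ T σ}, fun n => ?_⟩⟩
  rw [hT]
  refine and_congr_right fun _ => ⟨fun H j hj => H j hj, fun H p hp => ?_⟩
  exact H ⟨p, Finset.mem_biUnion.2 ⟨σ, by simpa using hσ, hp⟩⟩ hp

end IsEmbeddedStructure

end Difference

end PolyhedralSpaces

theorem theorem3p19 {X : Type*} [TopologicalSpace X] [SecondCountableTopology X]
    {N : Type*} [NormedAddCommGroup N] [InnerProductSpace ℝ N] [FiniteDimensional ℝ N]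
    (P : PolyhedralSpaces.QuasiEmbeddedPolyhedralSpace X N)
    (U : TopologicalSpace.Opens X)
    (K : PolyhedralSpaces.PolyhedralStructure X) (hK : P.IsComplex K)
    (hfin : (K.restriction U).Finite) :
    ∃ K' : PolyhedralSpaces.PolyhedralStructure X,
      P.IsComplex K' ∧ K'.IsSubdivision K ∧
        ∀ g ∈ K'.PA U, ∃ f₁ ∈ P.CPA K' U, ∃ f₂ ∈ P.CPA K' U, g = f₁ - f₂ := by
  obtain ⟨ℓ, -, hℓ⟩ := P.hyperplane
  have h := hK.2.isEmbeddedStructure hℓ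
  obtain ⟨A, hA⟩ := h.exists_isCutOut hfin
  set a : A → Module.Dual ℝ N := fun p => p
  have hr := h.refinement_isEmbeddedStructure a
  refine ⟨h.refinement a, PolyhedralSpaces.isComplex_refinement a P hK h,
    h.refinement_isSubdivision a, fun g hg => ?_⟩
  obtain ⟨C₁, hC₁⟩ := h.exists_forall_le hA hfin hg
  obtain ⟨C₂, hC₂⟩ := h.exists_forall_le hA hfin hr.zero_mem_PA
  set C := max (max C₁ C₂) 0
  set F := PolyhedralSpaces.IsEmbeddedStructure.arrangementFun P.ι U a
  have hF : C • F ∈ (h.refinement a).PA U := hr.smul_mem_PA h.arrangementFun_mem_PA C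
  refine ⟨g + C • F, ⟨hr.add_mem_PA hg hF, ?_⟩, 0 + C • F, ⟨hr.add_mem_PA hr.zero_mem_PA hF, ?_⟩,
    by abel⟩
  · exact PolyhedralSpaces.isConcave_of_forall_exists_le P
      (hC₁ C ((le_max_left _ _).trans (le_max_left _ _)) (le_max_right _ _))
  · exact PolyhedralSpaces.isConcave_of_forall_exists_le P
      (hC₂ C ((le_max_right _ _).trans (le_max_left _ _)) (le_max_right _ _))
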